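/- Let $E\subset\mathbb R^n$ be compact and such that every nonempty relatively open subset of $E$ has positive Lebesgue measure (e.g. $n=2$ and $E=[0,1]^2$). Let $k:E\times E\to\mathbb R$ be a continuous (hence bounded) kernel and $H_k$ its reproducing kernel Hilbert space, i.e. the Hilbert space of functions on $E$ with $k(\cdot,x)\in H_k$ and $f(x)=\langle k(\cdot,x),f\rangle_k$ for all $x\in E$, $f\in H_k$. Let $\mathcal K=\sum_{q\ge1}\lambda_q\,e_q\otimes e_q$ be a spectral decomposition of the integral operator $(\mathcal Kf)(x)=\int_E k(x,y)f(y)\,dy$ on $L^2(E)$: the eigenvalues $\lambda_1\ge\lambda_2\ge\cdots$ are listed with multiplicity (followed by zeros if $\mathcal K$ has finite rank), and the $e_q$ with $\lambda_q\neq0$ are $L^2$-orthonormal eigenfunctions, chosen so that $\mathcal Ke_q=\lambda_qe_q$ holds at every point of $E$. All sums below run over the $q$ with $\lambda_q\ne0$. (1) The functions $\sqrt{\lambda_q}\,e_q$ form an orthonormal basis of $H_k$. Every $\chi\in H_k$ has a unique expansion $$\chi=\sum_q\mu_q\,\sqrt{\lambda_q}\,e_q ,$$ convergent in $H_k$ and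 also at every point of $E$. (2) If $\chi_i=\sum_q\mu_{qi}\sqrt{\lambda_q}e_q$ and $\chi_j=\sum_q\mu_{qj}\sqrt{\lambda_q}e_q$ in $H_k$, then $\langle\chi_i,\chi_j\rangle_k=\sum_q\mu_{qi}\mu_{qj}$. (3) For points $a=(a_1,\dots,a_N)$ of $E$ let $K|_a=(k(a_i,a_j))_{i,j\le N}$. Then $\lambda_q\neq0$ for all $q\le d=\operatorname{rank}(K|_a)$. Let $a^{(m)}=(a^{(m)}_1,\dots,a^{(m)}_{N_m})$, $m\ge1$, be grids in $E$ which become uniformly distributed, i.e. $\frac1{N_m}\sum_l g(a^{(m)}_l)\to\frac1{|E|}\int_E g$ for all continuous $g:E\to\mathbb R$. Let $d_m=\operatorname{rank}(K|_{a^{(m)}})$ and let $(\ell^{(m)}_q,v^{(m)}_q)_{q\le N_m}$ be the eigenpairs of $K|_{a^{(m)}}$, with $\ell^{(m)}_1\ge\ell^{(m)}_2\ge\cdots$ and the $v^{(m)}_q$ orthonormal. Then there are spectral decompositions $\mathcal K=\sum_q\lambda_q\,e^{(m)}_q\otimes e^{(m)}_q$ of the same kind, with $e^{(m)}_q=\pm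 e_q$ whenever $\lambda_q\neq0$ is a simple eigenvalue, such that for every $q$ with $\lambda_q\ne0$: one has $q\le d_m$ for all large $m$, and for every $\varepsilon>0$ there is $m_0$ such that for all $m\ge m_0$ and all $\beta\in\mathbb R^{N_m}$ the function $\chi=\sum_{l}\beta_l\,k(\cdot,a^{(m)}_l)$, with expansion $\chi=\sum_q\mu_q\sqrt{\lambda_q}\,e^{(m)}_q$, satisfies $$\Bigl|\,\mu_q-\sqrt{\ell^{(m)}_q}\,\bigl(v^{(m)}_q\cdot\beta\bigr)\Bigr|\le\varepsilon\,\|\chi\|_k .$$ -/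

import Mathlib

open MeasureTheory Filter Topology
open scoped InnerProductSpace Matrix

noncomputable section

/-- `k` is the reproducing kernel of the Hilbert space `H` of real functions on `X`: for every `x`
the function `k(·, x)` belongs to `H`, and `f x = ⟨k(·, x), f⟩` for all `f` in `H`. -/
def IsReproducingKernel {X : Type*} (H : Type*) [NormedAddCommGroup H] [InnerProductSpace ℝ H]
    [RKHS ℝ H X ℝ] (k : X → X → ℝ) : Prop :=
  ∀ x : X, ∃ g : H, (∀ y, g y = k y x) ∧ ∀ f : H, f x = ⟪g, f⟫_ℝ

/-- Lebesgue measure on a subset `E` of `ℝⁿ`, as a measure on the subtype. -/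
abbrev lebesgueOn {n : ℕ} (E : Set (EuclideanSpace ℝ (Fin n))) : Measure E :=
  Measure.comap Subtype.val volume

/-- The integral operator with kernel `k` on functions on a measure space `(X, ν)`. -/
def integralOperator {X : Type*} [MeasurableSpace X] (ν : Measure X) (k : X → X → ℝ) (f : X → ℝ)
    (x : X) : ℝ :=
  ∫ y, k x y * f y ∂ν

/-- `(ev q, e q)`, `q = 0, 1, 2, …`, is a spectral decomposition `𝒦 = ∑ ev q • e q ⊗ e q` of the
integral operator `𝒦` of `k` on `L²(ν)`. The eigenvalues are listed in nonincreasing order with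
multiplicity; if `𝒦` has finite rank the list is filled up with zeros. The `e q` with `ev q ≠ 0` are
square integrable orthonormal eigenfunctions, normalized to satisfy the eigenvalue equation at
every point; the `e q` with `ev q = 0` play no role. -/
structure IsSpectralDecomposition {X : Type*} [MeasurableSpace X] (ν : Measure X)
    (k : X → X → ℝ) (ev : ℕ → ℝ) (e : ℕ → X → ℝ) : Prop where
  antitone : Antitone ev
  memLp : ∀ q, ev q ≠ 0 → MemLp (e q) 2 ν
  eigen : ∀ q, ev q ≠ 0 → ∀ x, integralOperator ν k (e q) x = ev q * e q x
  orthonormal : ∀ p q, ev p ≠ 0 → ev q ≠ 0 → ∫ x, e p x * e q x ∂ν = if p = q then 1 else 0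
  decomposition : ∀ f : X → ℝ, MemLp f 2 ν →
    Tendsto (fun Q : ℕ => eLpNorm (fun x => integralOperator ν k f x -
      ∑ q ∈ Finset.range Q, ev q * (∫ y, e q y * f y ∂ν) * e q x) 2 ν) atTop (𝓝 0)

/-- The indices of the nonzero eigenvalues. -/
abbrev NonzeroIndex (ev : ℕ → ℝ) : Type := {q : ℕ // ev q ≠ 0}

/-- `χ = ∑ q, μ q • (√(ev q) • e q)` in `H`, the sum being over the nonzero eigenvalues. -/
def HasExpansion {X : Type*} {H : Type*} [NormedAddCommGroup H] [InnerProductSpace ℝ H]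
    [RKHS ℝ H X ℝ] (ev : ℕ → ℝ) (e : ℕ → X → ℝ) (χ : H) (μ : NonzeroIndex ev → ℝ) : Prop :=
  ∃ u : NonzeroIndex ev → H, (∀ q x, u q x = √(ev q) * e q x) ∧ HasSum (fun q => μ q • u q) χ

/-- The Gram matrix of the kernel `k` at the points `a`. -/
def kernelMatrix {X : Type*} (k : X → X → ℝ) {N : ℕ} (a : Fin N → X) :
    Matrix (Fin N) (Fin N) ℝ :=
  Matrix.of fun i j => k (a i) (a j)

/-- `(ℓ q, v q)` are the eigenpairs of the matrix `A`: the eigenvalues in nonincreasing order with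
multiplicity, and an orthonormal basis of eigenvectors. -/
structure IsEigensystem {N : ℕ} (A : Matrix (Fin N) (Fin N) ℝ) (ℓ : Fin N → ℝ)
    (v : Fin N → Fin N → ℝ) : Prop where
  antitone : Antitone ℓ
  eigen : ∀ q, A *ᵥ v q = ℓ q • v q
  orthonormal : ∀ p q, v p ⬝ᵥ v q = if p = q then 1 else 0

/-- The grids `a m` become uniformly distributed in `X`: averages of continuous functions over
the grid converge to the average over `X`. -/
def IsEquidistributed {X : Type*} [TopologicalSpace X] [MeasurableSpace X] (ν : Measure X)
    {N : ℕ → ℕ} (a : ∀ m, Fin (N m) → X) : Prop :=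
  ∀ g : X → ℝ, Continuous g →
    Tendsto (fun m => (N m : ℝ)⁻¹ * ∑ l, g (a m l)) atTop
      (𝓝 ((ν.real Set.univ)⁻¹ * ∫ x, g x ∂ν))

end

/-!
Let `φ x = k(·, x)` be the canonical feature map of the reproducing kernel Hilbert space. The
covariance operator `C = ∫ φ(x) ⊗ φ(x) dx` has `√λ_q e_q` as an orthonormal basis of eigenvectors
with eigenvalues `λ_q`, so that `μ_q` is the inner product of `χ` with the `q`-th basis vector.

For a grid `a`, the Gram matrix `K|_a` has the nonzero eigenvalues of the frame operator
`∑ φ(a_l) ⊗ φ(a_l)`, with unit eigenvectors `w_q = ℓ_q^{-1/2} ∑ v_q(l) φ(a_l)`. If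
`χ = ∑ β_l φ(a_l)` then `⟨w_q, χ⟩ = √ℓ_q (v_q · β)` exactly, so the claimed estimate says that `w_q`
is close to the `q`-th vector of a suitable eigenbasis of `C`.

By equidistribution, the frame operators multiplied by `|E| / N_m` converge to `C` in norm, and so
do their ordered eigenvalues by Weyl's inequality. As the eigenspace of `C` for `λ_q` is isolated
from the rest of the spectrum, `w_q` is close to it. The projections of the `w_q` to the eigenspace
have a Gram matrix close to `1`, hence by compactness they are close to an orthonormal basis of it.
-/

section NearestOrthonormalBasis

theorem tendsto_infDist_preimage_singleton {κ X Y : Type*} [PseudoMetricSpace X]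
    [TopologicalSpace Y] [T2Space Y] {l : Filter κ} {K : Set X} (hK : IsCompact K) {f : X → Y}
    (hf : Continuous f) {c : Y} {u : κ → X} (hu : ∀ᶠ i in l, u i ∈ K)
    (hfu : Tendsto (fun i => f (u i)) l (𝓝 c)) :
    Tendsto (fun i => Metric.infDist (u i) (f ⁻¹' {c})) l (𝓝 0) := by
  refine Metric.tendsto_nhds.2 fun ε hε => ?_
  set D := K ∩ {x | ε ≤ Metric.infDist x (f ⁻¹' {c})}
  have hD : IsCompact D :=
    hK.inter_right (isClosed_le continuous_const (Metric.continuous_infDist_pt _))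
  have hc : c ∉ f '' D := by
    rintro ⟨x, ⟨-, hx⟩, hfx⟩
    rw [Set.mem_ofPred_eq, Metric.infDist_zero_of_mem (show x ∈ f ⁻¹' {c} from hfx)] at hx
    exact hx.not_gt hε
  have hev := hfu.eventually ((hD.image hf).isClosed.isOpen_compl.mem_nhds hc)
  filter_upwards [hu, hev] with i hi hfi
  rw [Real.dist_0_eq_abs, abs_of_nonneg Metric.infDist_nonneg]
  exact not_le.1 fun h => hfi ⟨u i, ⟨hi, h⟩, rfl⟩

theorem exists_orthonormalBasis_tendsto_sub {κ ι V : Type*} [Fintype ι] [DecidableEq ι]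
    [NormedAddCommGroup V] [InnerProductSpace ℝ V] (b : OrthonormalBasis ι ℝ V) {l : Filter κ}
    {u : κ → ι → V} (hu : Tendsto (fun m => Matrix.gram ℝ (u m)) l (𝓝 1)) :
    ∃ o : κ → OrthonormalBasis ι ℝ V, Tendsto (fun m => ⇑(o m) - u m) l (𝓝 0) := by
  have : FiniteDimensional ℝ V := b.toBasis.finiteDimensional_of_finite
  have hcont : Continuous fun w : ι → V => Matrix.gram ℝ w :=
    continuous_matrix fun p q => by simp only [Matrix.gram_apply]; fun_prop
  have hbdd : ∀ᶠ m in l, u m ∈ Metric.closedBall (0 : ι → V) 2 := by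
    have hdiag (q : ι) : ∀ᶠ m in l, ⟪u m q, u m q⟫_ℝ < 2 := by
      have : Tendsto (fun m => ⟪u m q, u m q⟫_ℝ) l (𝓝 1) := by
        simpa using tendsto_pi_nhds.1 (tendsto_pi_nhds.1 hu q) q
      exact this.eventually_lt_const one_lt_two
    filter_upwards [eventually_all.2 hdiag] with m hm
    rw [mem_closedBall_zero_iff, pi_norm_le_iff_of_nonneg zero_le_two]
    intro q
    have := hm q
    rw [real_inner_self_eq_norm_sq] at this
    nlinarith [norm_nonneg (u m q)]
  have hne : ((Matrix.gram ℝ : (ι → V) → _) ⁻¹' {1}).Nonempty :=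
    ⟨b, Matrix.gram_eq_one_iff_orthonormal.2 b.orthonormal⟩
  choose o ho hdist using fun m =>
    (isClosed_singleton.preimage hcont).exists_infDist_eq_dist hne (u m)
  have horth (m : κ) : Orthonormal ℝ (o m) := Matrix.gram_eq_one_iff_orthonormal.1 (ho m)
  have hspan (m : κ) : ⊤ ≤ Submodule.span ℝ (Set.range (o m)) :=
    ((horth m).linearIndependent.span_eq_top_of_card_eq_finrank'
      (Module.finrank_eq_card_basis b.toBasis).symm).ge
  refine ⟨fun m => .mk (horth m) (hspan m), tendsto_zero_iff_norm_tendsto_zero.2 ?_⟩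
  simpa only [OrthonormalBasis.coe_mk, ← dist_eq_norm, dist_comm, ← hdist] using
    tendsto_infDist_preimage_singleton (isCompact_closedBall 0 2) hcont hbdd hu

end NearestOrthonormalBasis

section Weyl

variable {ι κ H : Type*} [NormedAddCommGroup H] [InnerProductSpace ℝ H]

theorem norm_sq_eq_sum_inner_sq_of_mem_span [Fintype ι] {u : ι → H} (hu : Orthonormal ℝ u) {x : H}
    (hx : x ∈ Submodule.span ℝ (Set.range u)) : ‖x‖ ^ 2 = ∑ i, ⟪u i, x⟫_ℝ ^ 2 := by
  obtain ⟨c, rfl⟩ := Submodule.mem_span_range_iff_exists_fun ℝ |>.1 hx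
  rw [← real_inner_self_eq_norm_sq, hu.inner_sum]
  simp only [hu.inner_right_fintype, conj_trivial, sq]

theorem exists_mem_ne_zero_inner_eq_zero [Fintype κ] {V : Submodule ℝ H}
    (hV : Fintype.card κ < Module.finrank ℝ V) (z : κ → H) :
    ∃ x ∈ V, x ≠ 0 ∧ ∀ j, ⟪z j, x⟫_ℝ = 0 := by
  have : FiniteDimensional ℝ V := Module.finite_of_finrank_pos (hV.pos)
  let f : V →ₗ[ℝ] κ → ℝ := LinearMap.pi fun j => innerₛₗ ℝ (z j) ∘ₗ V.subtype
  have hker : LinearMap.ker f ≠ ⊥ := LinearMap.ker_ne_bot_of_finrank_lt (by simpa using hV)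
  obtain ⟨x, hx, hx0⟩ := Submodule.exists_mem_ne_zero_of_ne_bot hker
  exact ⟨x, x.2, by simpa using hx0, fun j => congrFun (LinearMap.mem_ker.1 hx) j⟩

/-- The bounded operator `A` is represented as `∑ q, α q • u q ⊗ u q` with nonincreasing
nonnegative eigenvalues `α q`, where the `u q` with `α q ≠ 0` are orthonormal and the others play
no role. The expansion is required only of the quadratic form of `A`, which is all that the
min-max principle needs. -/
structure IsEigenexpansion (A : H →L[ℝ] H) (α : ℕ → ℝ) (u : ℕ → H) : Prop where
  antitone : Antitone α
  nonneg : ∀ q, 0 ≤ α q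
  orthonormal : Orthonormal ℝ fun q : NonzeroIndex α => u q
  hasSum_inner : ∀ x, HasSum (fun q => α q * ⟪u q, x⟫_ℝ ^ 2) ⟪x, A x⟫_ℝ

namespace IsEigenexpansion

variable {A B : H →L[ℝ] H} {α β : ℕ → ℝ} {u v : ℕ → H}

theorem inner_apply_le (hA : IsEigenexpansion A α u) {q : ℕ} {x : H}
    (hx : ∀ i < q, ⟪u i, x⟫_ℝ = 0) : ⟪x, A x⟫_ℝ ≤ α q * ‖x‖ ^ 2 := by
  have hsum : HasSum (fun p : NonzeroIndex α => α p * ⟪u p, x⟫_ℝ ^ 2) ⟪x, A x⟫_ℝ :=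
    (hasSum_subtype_iff_of_support_subset (s := {p | α p ≠ 0})
      (Function.support_mul_subset_left _ _)).2 (hA.hasSum_inner x)
  refine hasSum_le_of_sum_le hsum fun s => ?_
  calc ∑ p ∈ s, α p * ⟪u p, x⟫_ℝ ^ 2 ≤ ∑ p ∈ s, α q * ⟪u p, x⟫_ℝ ^ 2 := by
        refine Finset.sum_le_sum fun p _ => ?_
        obtain hp | hp := lt_or_ge (p : ℕ) q
        · simp [hx p hp]
        · gcongr
          exact hA.antitone hp
    _ = α q * ∑ p ∈ s, ‖⟪u p, x⟫_ℝ‖ ^ 2 := by simp only [Finset.mul_sum, Real.norm_eq_abs, sq_abs]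
    _ ≤ α q * ‖x‖ ^ 2 := by
        gcongr
        exacts [hA.nonneg q, hA.orthonormal.sum_inner_products_le x]

theorem orthonormal_fin (hA : IsEigenexpansion A α u) {q : ℕ} (hq : α q ≠ 0) :
    Orthonormal ℝ fun i : Fin (q + 1) => u i :=
  hA.orthonormal.comp
    (fun i : Fin (q + 1) => ⟨i, (((hA.nonneg q).lt_of_ne' hq).trans_le
      (hA.antitone (Nat.lt_succ_iff.1 i.2))).ne'⟩)
    fun _ _ h => Fin.ext (congrArg Subtype.val h)

theorem le_inner_apply (hA : IsEigenexpansion A α u) {q : ℕ} (hq : α q ≠ 0) {x : H}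
    (hx : x ∈ Submodule.span ℝ (Set.range fun i : Fin (q + 1) => u i)) :
    α q * ‖x‖ ^ 2 ≤ ⟪x, A x⟫_ℝ := by
  calc α q * ‖x‖ ^ 2 = ∑ i : Fin (q + 1), α q * ⟪u i, x⟫_ℝ ^ 2 := by
        rw [norm_sq_eq_sum_inner_sq_of_mem_span (hA.orthonormal_fin hq) hx, Finset.mul_sum]
    _ ≤ ∑ i : Fin (q + 1), α i * ⟪u i, x⟫_ℝ ^ 2 := by
        gcongr with i
        exact hA.antitone (Nat.lt_succ_iff.1 i.2)
    _ = ∑ p ∈ Finset.range (q + 1), α p * ⟪u p, x⟫_ℝ ^ 2 :=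
        Fin.sum_univ_eq_sum_range (fun p => α p * ⟪u p, x⟫_ℝ ^ 2) (q + 1)
    _ ≤ ⟪x, A x⟫_ℝ := sum_le_hasSum _
        (fun p _ => mul_nonneg (hA.nonneg p) (sq_nonneg _)) (hA.hasSum_inner x)

theorem le_add_norm_sub (hA : IsEigenexpansion A α u) (hB : IsEigenexpansion B β v) (q : ℕ) :
    α q ≤ β q + ‖A - B‖ := by
  obtain hq | hq := eq_or_ne (α q) 0
  · rw [hq]
    have := hB.nonneg q
    positivity
  obtain ⟨x, hxu, hx0, hxv⟩ := exists_mem_ne_zero_inner_eq_zero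
    (V := Submodule.span ℝ (Set.range fun i : Fin (q + 1) => u i))
    (by simp [finrank_span_eq_card (hA.orthonormal_fin hq).linearIndependent])
    fun j : Fin q => v j
  have hdiff : ⟪x, A x⟫_ℝ - ⟪x, B x⟫_ℝ ≤ ‖A - B‖ * ‖x‖ ^ 2 :=
    calc ⟪x, A x⟫_ℝ - ⟪x, B x⟫_ℝ = ⟪x, (A - B) x⟫_ℝ := (inner_sub_right _ _ _).symm
      _ ≤ ‖x‖ * (‖A - B‖ * ‖x‖) :=
        (real_inner_le_norm _ _).trans (by gcongr; exact (A - B).le_opNorm x)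
      _ = ‖A - B‖ * ‖x‖ ^ 2 := by ring
  have hlow := hA.le_inner_apply hq hxu
  have hup := hB.inner_apply_le (q := q) fun i hi => hxv ⟨i, hi⟩
  refine le_of_mul_le_mul_right (a := ‖x‖ ^ 2) ?_ (by positivity)
  linarith

theorem abs_sub_le (hA : IsEigenexpansion A α u) (hB : IsEigenexpansion B β v) (q : ℕ) :
    |α q - β q| ≤ ‖A - B‖ := by
  have h₁ := hA.le_add_norm_sub hB q
  have h₂ := hB.le_add_norm_sub hA q
  rw [norm_sub_rev] at h₂
  exact abs_sub_le_iff.2 ⟨by linarith, by linarith⟩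

theorem smul (hA : IsEigenexpansion A α u) {c : ℝ} (hc : 0 ≤ c) :
    IsEigenexpansion (c • A) (c • α) u where
  antitone _ _ hpq := mul_le_mul_of_nonneg_left (hA.antitone hpq) hc
  nonneg q := mul_nonneg hc (hA.nonneg q)
  orthonormal := hA.orthonormal.comp
    (fun q : NonzeroIndex (c • α) => ⟨q, right_ne_zero_of_mul q.2⟩)
    fun _ _ h => Subtype.ext (Subtype.mk.inj h)
  hasSum_inner x := by
    simpa only [_root_.smul_apply, inner_smul_right, Pi.smul_apply, smul_eq_mul, mul_assoc]
      using (hA.hasSum_inner x).mul_left c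

end IsEigenexpansion

end Weyl

section Eigenbasis

variable {ι κ H : Type*} [NormedAddCommGroup H] [InnerProductSpace ℝ H]

theorem hasSum_inner_sq (b : HilbertBasis ι ℝ H) (x : H) :
    HasSum (fun i => ⟪b i, x⟫_ℝ ^ 2) (‖x‖ ^ 2) := by
  simpa only [real_inner_self_eq_norm_sq, real_inner_comm, ← sq] using b.hasSum_inner_mul_inner x x

/-- The Hilbert basis `b` consists of eigenvectors of `A`, with eigenvalues `Λ`. -/
def IsEigenbasis (A : H →L[ℝ] H) (Λ : ι → ℝ) (b : HilbertBasis ι ℝ H) : Prop :=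
  ∀ p, A (b p) = Λ p • b p

theorem finite_fiber {Λ : ι → ℝ} (hΛ : Tendsto Λ cofinite (𝓝 0)) (hΛ₀ : ∀ q, Λ q ≠ 0) (μ : ℝ) :
    Finite {p // Λ p = μ} := by
  obtain rfl | hμ := eq_or_ne μ 0
  · simp only [hΛ₀]
    infer_instance
  · have : {p | Λ p = μ}.Finite := by
      simpa [Set.compl_ofPred] using mem_cofinite.1 (hΛ.eventually_ne hμ.symm)
    exact this.to_subtype

theorem exists_pos_le_abs_sub_of_ne {Λ : ι → ℝ} (hΛ : Tendsto Λ cofinite (𝓝 0)) {μ : ℝ}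
    (hμ : μ ≠ 0) : ∃ γ > 0, ∀ p, Λ p ≠ μ → γ ≤ |Λ p - μ| := by
  have hfar : ∀ᶠ p in cofinite, |μ| / 2 ≤ |Λ p - μ| := by
    have : Tendsto (fun p => |Λ p - μ|) cofinite (𝓝 |μ|) := by
      simpa using (hΛ.sub_const μ).abs
    exact this.eventually_const_le (half_lt_self (abs_pos.2 hμ))
  have hpos {δ : ℝ} (hδ : 0 < δ) : ∀ᶠ γ in 𝓝[>] (0 : ℝ), γ ≤ δ :=
    nhdsWithin_le_nhds (eventually_le_nhds hδ)
  have hnear : ∀ᶠ γ in 𝓝[>] (0 : ℝ), ∀ p ∈ {p | ¬ |μ| / 2 ≤ |Λ p - μ|}, Λ p ≠ μ → γ ≤ |Λ p - μ| :=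
    (eventually_all_finite hfar).2 fun p _ => eventually_imp_distrib_left.2 fun hp =>
      hpos (abs_pos.2 (sub_ne_zero.2 hp))
  obtain ⟨γ, ⟨hγ, hγ'⟩, hγ₀⟩ := (((hpos (half_pos (abs_pos.2 hμ))).and hnear).and
    self_mem_nhdsWithin).exists
  refine ⟨γ, hγ₀, fun p hp => ?_⟩
  by_cases h : |μ| / 2 ≤ |Λ p - μ|
  exacts [hγ.trans h, hγ' p h hp]

theorem tendsto_inner_starProjection {K : Submodule ℝ H} [K.HasOrthogonalProjection] {l : Filter κ}
    {x y : κ → H} {c : ℝ} (hx : l.IsBoundedUnder (· ≤ ·) fun m => ‖x m‖)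
    (hxy : Tendsto (fun m => ⟪x m, y m⟫_ℝ) l (𝓝 c))
    (hy : Tendsto (fun m => y m - K.starProjection (y m)) l (𝓝 0)) :
    Tendsto (fun m => ⟪K.starProjection (x m), K.starProjection (y m)⟫_ℝ) l (𝓝 c) := by
  have hzero : Tendsto (fun m => ⟪x m, y m - K.starProjection (y m)⟫_ℝ) l (𝓝 0) :=
    squeeze_zero_norm (fun _ => norm_inner_le_norm _ _)
      (isBoundedUnder_le_mul_tendsto_zero (by simpa [Function.comp_def] using hx)
        (by simpa using hy.norm))
  rw [← sub_zero c]
  refine (hxy.sub hzero).congr fun m => ?_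
  rw [inner_sub_right, sub_sub_cancel, Submodule.inner_starProjection_left_eq_right,
    K.starProjection_eq_self_iff.2 (K.starProjection_apply_mem _)]

namespace IsEigenbasis

open Module.End (eigenspace mem_eigenspace_iff)

variable {A : H →L[ℝ] H} {Λ : ι → ℝ} {b : HilbertBasis ι ℝ H}

theorem inner_apply (hb : IsEigenbasis A Λ b) (p : ι) (x : H) :
    ⟪b p, A x⟫_ℝ = Λ p * ⟪b p, x⟫_ℝ := by
  classical
  suffices innerSL ℝ (b p) ∘L A = Λ p • innerSL ℝ (b p) from DFunLike.congr_fun this x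
  have hdense := Submodule.dense_iff_topologicalClosure_eq_top.2 b.dense_span
  refine ContinuousLinearMap.ext_on hdense ?_
  rintro _ ⟨q, rfl⟩
  obtain rfl | hpq := eq_or_ne p q
  · simp [hb p]
  · simp [hb q, b.orthonormal.2 hpq]

theorem isSymmetric (hb : IsEigenbasis A Λ b) : (A : H →ₗ[ℝ] H).IsSymmetric := fun x y => by
  rw [ContinuousLinearMap.coe_coe, ← b.tsum_inner_mul_inner, ← b.tsum_inner_mul_inner]
  refine tsum_congr fun p => ?_
  rw [real_inner_comm, hb.inner_apply, hb.inner_apply, real_inner_comm]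
  ring

theorem hasSum_inner_apply (hb : IsEigenbasis A Λ b) (x : H) :
    HasSum (fun p => Λ p * ⟪b p, x⟫_ℝ ^ 2) ⟪x, A x⟫_ℝ := by
  refine (b.hasSum_inner_mul_inner x (A x)).congr_fun fun p => ?_
  rw [hb.inner_apply, real_inner_comm]
  ring

theorem isEigenexpansion {α : ℕ → ℝ} {b : HilbertBasis (NonzeroIndex α) ℝ H} (hα : Antitone α)
    (hα₀ : ∀ q, 0 ≤ α q) (hb : IsEigenbasis A (fun q : NonzeroIndex α => α q) b) :
    IsEigenexpansion A α (Function.extend Subtype.val b 0) where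
  antitone := hα
  nonneg := hα₀
  orthonormal := by simpa only [Subtype.val_injective.extend_apply] using b.orthonormal
  hasSum_inner x := by
    refine (hasSum_subtype_iff_of_support_subset (s := {p | α p ≠ 0})
      (Function.support_mul_subset_left _ _)).1 ?_
    simp only [Function.comp_def, Subtype.val_injective.extend_apply]
    exact hb.hasSum_inner_apply x

theorem inner_eq_zero_of_ne (hb : IsEigenbasis A Λ b) {μ : ℝ} {x : H}
    (hx : x ∈ eigenspace (A : H →ₗ[ℝ] H) μ) {p : ι} (hp : Λ p ≠ μ) : ⟪b p, x⟫_ℝ = 0 := by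
  have h := hb.inner_apply p x
  rw [show A x = μ • x from mem_eigenspace_iff.1 hx, inner_smul_right, ← sub_eq_zero,
    ← sub_mul] at h
  exact (mul_eq_zero.1 h).resolve_left (sub_ne_zero.2 hp.symm)

theorem sum_inner_smul_of_mem_eigenspace (hb : IsEigenbasis A Λ b) {μ : ℝ}
    [Fintype {p // Λ p = μ}] {x : H} (hx : x ∈ eigenspace (A : H →ₗ[ℝ] H) μ) :
    ∑ p : {p // Λ p = μ}, ⟪b p, x⟫_ℝ • b p = x := by
  have hsum := b.hasSum_repr x
  simp only [b.repr_apply_apply] at hsum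
  refine (hasSum_fintype _).unique <| (hasSum_subtype_iff_of_support_subset
    (s := {p | Λ p = μ}) fun p hp => ?_).2 hsum
  by_contra hne
  exact hp (by simp only [hb.inner_eq_zero_of_ne hx hne, zero_smul])

theorem eq_or_eq_neg (hb : IsEigenbasis A Λ b) {q : ι} (hq : ∀ p, p ≠ q → Λ p ≠ Λ q) {x : H}
    (hx : A x = Λ q • x) (hnorm : ‖x‖ = 1) : x = b q ∨ x = -b q := by
  let : Unique {p // Λ p = Λ q} :=
    ⟨⟨q, rfl⟩, fun p => Subtype.ext (not_imp_comm.1 (hq p) (not_not.2 p.2))⟩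
  have hxq : ⟪b q, x⟫_ℝ • b q = x := by
    have := hb.sum_inner_smul_of_mem_eigenspace (mem_eigenspace_iff.2 hx)
    rwa [Fintype.sum_unique] at this
  have habs : |⟪b q, x⟫_ℝ| = 1 := by
    simpa [norm_smul, b.orthonormal.1 q, hnorm] using congrArg norm hxq
  obtain h | h := eq_or_eq_neg_of_abs_eq habs
  · exact .inl (by rw [← hxq, h, one_smul])
  · exact .inr (by rw [← hxq, h, neg_one_smul])

theorem mem_eigenspace (hb : IsEigenbasis A Λ b) {μ : ℝ} (p : {p // Λ p = μ}) :
    b p ∈ eigenspace (A : H →ₗ[ℝ] H) μ :=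
  mem_eigenspace_iff.2 <| (hb p).trans (by rw [p.2])

/-- The basis vectors with eigenvalue `μ`, as an orthonormal basis of the eigenspace. -/
noncomputable def orthonormalBasis (hb : IsEigenbasis A Λ b) (μ : ℝ) [Fintype {p // Λ p = μ}] :
    OrthonormalBasis {p // Λ p = μ} ℝ (eigenspace (A : H →ₗ[ℝ] H) μ) :=
  .mk (v := fun p => ⟨b p, hb.mem_eigenspace p⟩)
    ((b.orthonormal.comp _ Subtype.val_injective).codRestrict _ hb.mem_eigenspace)
    fun x _ => (Submodule.mem_span_range_iff_exists_fun ℝ).2 ⟨fun p => ⟪b p, x⟫_ℝ,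
      Subtype.ext <| by simpa using hb.sum_inner_smul_of_mem_eigenspace x.2⟩

theorem exists_of_orthonormalBasis [CompleteSpace H] (hb : IsEigenbasis A Λ b)
    [∀ μ, Fintype {p // Λ p = μ}]
    (o : ∀ μ, OrthonormalBasis {p // Λ p = μ} ℝ (eigenspace (A : H →ₗ[ℝ] H) μ)) :
    ∃ b' : HilbertBasis ι ℝ H, IsEigenbasis A Λ b' ∧ ∀ p, b' p = o (Λ p) ⟨p, rfl⟩ := by
  let u : ι → H := fun p => o (Λ p) ⟨p, rfl⟩
  have horth : Orthonormal ℝ u :=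
    (hb.isSymmetric.orthogonalFamily_eigenspaces.orthonormal_sigma_orthonormal
      fun μ => (o μ).orthonormal).comp _ (Equiv.sigmaFiberEquiv Λ).symm.injective
  have hu (μ : ℝ) (p : {p // Λ p = μ}) : (o μ p : H) = u p := by
    obtain ⟨p, rfl⟩ := p
    rfl
  have hspan : ⊤ ≤ (Submodule.span ℝ (Set.range u)).topologicalClosure := by
    rw [← b.dense_span]
    refine Submodule.topologicalClosure_mono (Submodule.span_le.2 ?_)
    rintro _ ⟨q, rfl⟩
    have hq := congrArg Subtype.val ((o (Λ q)).sum_repr ⟨b q, hb.mem_eigenspace ⟨q, rfl⟩⟩)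
    rw [SetLike.mem_coe, ← show _ = b q from hq, Submodule.coe_sum]
    refine Submodule.sum_mem _ fun p _ => Submodule.smul_mem _ _ (Submodule.subset_span ⟨p, ?_⟩)
    exact (hu _ p).symm
  refine ⟨.mk horth hspan, fun p => ?_, fun p => congrFun (HilbertBasis.coe_mk _ _) p⟩
  rw [HilbertBasis.coe_mk]
  exact mem_eigenspace_iff.1 (o (Λ p) ⟨p, rfl⟩).2

theorem mul_norm_sub_starProjection_le (hb : IsEigenbasis A Λ b) {μ γ : ℝ}
    [(eigenspace (A : H →ₗ[ℝ] H) μ).HasOrthogonalProjection] (hγ : 0 ≤ γ)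
    (hgap : ∀ p, Λ p ≠ μ → γ ≤ |Λ p - μ|) (x : H) :
    γ * ‖x - (eigenspace (A : H →ₗ[ℝ] H) μ).starProjection x‖ ≤ ‖A x - μ • x‖ := by
  set y := (eigenspace (A : H →ₗ[ℝ] H) μ).starProjection x
  have hy : y ∈ eigenspace (A : H →ₗ[ℝ] H) μ := Submodule.starProjection_apply_mem _ _
  have hcoeff (p : ι) : γ * |⟪b p, x - y⟫_ℝ| ≤ |⟪b p, A x - μ • x⟫_ℝ| := by
    rw [inner_sub_right _ (A x), hb.inner_apply, inner_smul_right, ← sub_mul, abs_mul]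
    obtain hp | hp := eq_or_ne (Λ p) μ
    · have : ⟪b p, x - y⟫_ℝ = 0 :=
        Submodule.sub_starProjection_mem_orthogonal x _ (hb.mem_eigenspace ⟨p, hp⟩)
      simp [this, hp]
    · rw [inner_sub_right, hb.inner_eq_zero_of_ne hy hp, sub_zero]
      gcongr
      exact hgap p hp
  have hsq : (γ * ‖x - y‖) ^ 2 ≤ ‖A x - μ • x‖ ^ 2 := by
    rw [mul_pow]
    refine hasSum_le (fun p => ?_) ((hasSum_inner_sq b _).mul_left _) (hasSum_inner_sq b _)
    rw [← mul_pow]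
    exact sq_le_sq.2 (by simpa [abs_mul, abs_of_nonneg hγ] using hcoeff p)
  exact le_of_sq_le_sq hsq (norm_nonneg _)

theorem tendsto_sub_starProjection (hb : IsEigenbasis A Λ b) (hΛ : Tendsto Λ cofinite (𝓝 0))
    {μ : ℝ} (hμ : μ ≠ 0) [(eigenspace (A : H →ₗ[ℝ] H) μ).HasOrthogonalProjection]
    {l : Filter κ} {w : κ → H} (hw : Tendsto (fun m => A (w m) - μ • w m) l (𝓝 0)) :
    Tendsto (fun m => w m - (eigenspace (A : H →ₗ[ℝ] H) μ).starProjection (w m)) l (𝓝 0) := by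
  obtain ⟨γ, hγ, hgap⟩ := exists_pos_le_abs_sub_of_ne hΛ hμ
  refine squeeze_zero_norm (fun m => ?_) (by simpa using hw.norm.const_mul γ⁻¹)
  exact (le_inv_mul_iff₀ hγ).2 (hb.mul_norm_sub_starProjection_le hγ.le hgap _)

theorem exists_tendsto_sub [CompleteSpace H] [DecidableEq ι] (hb : IsEigenbasis A Λ b)
    (hΛ : Tendsto Λ cofinite (𝓝 0)) (hΛ₀ : ∀ q, Λ q ≠ 0) {l : Filter κ} {w : κ → ι → H}
    (hw : ∀ q, Tendsto (fun m => A (w m q) - Λ q • w m q) l (𝓝 0))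
    (horth : Tendsto (fun m => Matrix.gram ℝ (w m)) l (𝓝 1)) :
    ∃ b' : κ → HilbertBasis ι ℝ H, (∀ m, IsEigenbasis A Λ (b' m)) ∧
      ∀ q, Tendsto (fun m => b' m q - w m q) l (𝓝 0) := by
  have hinner (p q : ι) : Tendsto (fun m => ⟪w m p, w m q⟫_ℝ) l (𝓝 ((1 : Matrix ι ι ℝ) p q)) :=
    tendsto_pi_nhds.1 (tendsto_pi_nhds.1 horth p) q
  have (μ : ℝ) : Fintype {p // Λ p = μ} := @Fintype.ofFinite _ (finite_fiber hΛ hΛ₀ μ)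
  have (μ : ℝ) : FiniteDimensional ℝ (eigenspace (A : H →ₗ[ℝ] H) μ) :=
    (hb.orthonormalBasis μ).toBasis.finiteDimensional_of_finite
  have hproj (q : ι) := hb.tendsto_sub_starProjection hΛ (hΛ₀ q) (hw q)
  have hgram (μ : ℝ) : Tendsto (fun m => Matrix.gram ℝ fun p : {p // Λ p = μ} =>
      (eigenspace (A : H →ₗ[ℝ] H) μ).orthogonalProjectionOnto (w m p)) l (𝓝 1) := by
    refine tendsto_pi_nhds.2 fun p => tendsto_pi_nhds.2 fun q => ?_
    have hq := hproj q
    rw [q.2] at hq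
    have hbdd : l.IsBoundedUnder (· ≤ ·) fun m => ‖w m p‖ := by
      have : Tendsto (fun m => √⟪w m p, w m p⟫_ℝ) l (𝓝 √1) := by
        simpa using (hinner p p).sqrt
      simpa only [norm_eq_sqrt_real_inner] using this.isBoundedUnder_le
    have hone : (1 : Matrix {p // Λ p = μ} _ ℝ) p q = (1 : Matrix ι ι ℝ) p q := by
      simp only [Matrix.one_apply, Subtype.ext_iff]
    exact hone ▸ tendsto_inner_starProjection hbdd (hinner p q) hq
  choose o ho using fun μ => exists_orthonormalBasis_tendsto_sub (hb.orthonormalBasis μ) (hgram μ)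
  choose b' hb' hbo using fun m => hb.exists_of_orthonormalBasis (o · m)
  refine ⟨b', hb', fun q => ?_⟩
  have hclose : Tendsto
      (fun m => b' m q - (eigenspace (A : H →ₗ[ℝ] H) (Λ q)).starProjection (w m q)) l (𝓝 0) := by
    have := ((eigenspace (A : H →ₗ[ℝ] H) (Λ q)).subtypeL.continuous.tendsto 0).comp
      (tendsto_pi_nhds.1 (ho (Λ q)) ⟨q, rfl⟩)
    simpa [Function.comp_def, hbo] using this
  simpa using hclose.sub (hproj q)

end IsEigenbasis

end Eigenbasis

section Equidistribution

variable {X F : Type*} [NormedAddCommGroup F] [NormedSpace ℝ F]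

theorem norm_sub_sum_smul_le_of_sum_eq_one {ι : Type*} {t : Finset ι} {w : ι → ℝ} {y : ι → F}
    {x : F} {ε : ℝ} (hw : ∀ i ∈ t, 0 ≤ w i) (hsum : ∑ i ∈ t, w i = 1)
    (hy : ∀ i ∈ t, w i ≠ 0 → ‖x - y i‖ ≤ ε) : ‖x - ∑ i ∈ t, w i • y i‖ ≤ ε := by
  have hx : x - ∑ i ∈ t, w i • y i = ∑ i ∈ t, w i • (x - y i) := by
    simp only [smul_sub, Finset.sum_sub_distrib, ← Finset.sum_smul, hsum, one_smul]
  calc ‖x - ∑ i ∈ t, w i • y i‖ ≤ ∑ i ∈ t, w i * ε := by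
        rw [hx]
        refine norm_sum_le_of_le _ fun i hi => ?_
        rw [norm_smul, Real.norm_of_nonneg (hw i hi)]
        rcases eq_or_ne (w i) 0 with h | h
        · simp [h]
        · exact mul_le_mul_of_nonneg_left (hy i hi h) (hw i hi)
    _ = ε := by rw [← Finset.sum_mul, hsum, one_mul]

theorem norm_inv_smul_sum_le {N : ℕ} {y : Fin N → F} {ε : ℝ} (hε : 0 ≤ ε)
    (hy : ∀ l, ‖y l‖ ≤ ε) : ‖(N : ℝ)⁻¹ • ∑ l, y l‖ ≤ ε := by
  rw [norm_smul, norm_inv, Real.norm_natCast]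
  refine inv_mul_le_of_le_mul₀ (Nat.cast_nonneg N) hε ?_
  simpa using norm_sum_le_of_le Finset.univ fun l _ => hy l

theorem norm_inv_measureReal_smul_integral_le [MeasurableSpace X] {ν : Measure X}
    [IsFiniteMeasure ν] {G : X → F} {ε : ℝ} (hε : 0 ≤ ε)
    (hG : ∀ x, ‖G x‖ ≤ ε) : ‖(ν.real Set.univ)⁻¹ • ∫ x, G x ∂ν‖ ≤ ε := by
  rw [norm_smul, norm_inv, Real.norm_of_nonneg measureReal_nonneg]
  refine inv_mul_le_of_le_mul₀ measureReal_nonneg hε ?_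
  rw [mul_comm]
  exact norm_integral_le_of_norm_le_const (Eventually.of_forall hG)

variable [TopologicalSpace X] [CompactSpace X]

theorem exists_continuous_norm_sub_sum_smul_le {G : X → F} (hG : Continuous G) {ε : ℝ}
    (hε : 0 < ε) :
    ∃ (t : Finset X) (c : X → X → ℝ), (∀ i, Continuous (c i)) ∧
      ∀ x, ‖G x - ∑ i ∈ t, c i x • G i‖ ≤ ε := by
  let ψ : X → X → ℝ := fun i x => max 0 (ε - ‖G x - G i‖)
  have hψ (i : X) : Continuous (ψ i) := by fun_prop
  have hψ₀ (i x : X) : 0 ≤ ψ i x := le_max_left _ _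
  obtain ⟨t, -, ht⟩ := isCompact_univ.elim_nhds_subcover (fun i => {x | 0 < ψ i x}) fun i _ =>
    (hψ i).continuousAt.eventually_const_lt (by simpa [ψ] using hε)
  have hpos (x : X) : 0 < ∑ i ∈ t, ψ i x := by
    obtain ⟨i, hi, hx⟩ := Set.mem_iUnion₂.1 (ht (Set.mem_univ x))
    exact Finset.sum_pos' (fun i _ => hψ₀ i x) ⟨i, hi, hx⟩
  refine ⟨t, fun i x => ψ i x / ∑ j ∈ t, ψ j x,
    fun i => (hψ i).div (continuous_finsetSum _ fun j _ => hψ j) fun x => (hpos x).ne',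
    fun x => norm_sub_sum_smul_le_of_sum_eq_one (fun i _ => div_nonneg (hψ₀ i x) (hpos x).le) ?_
      fun i _ hi => ?_⟩
  · rw [← Finset.sum_div, div_self (hpos x).ne']
  · contrapose! hi
    rw [show ψ i x = 0 from max_eq_left (by linarith), zero_div]

namespace IsEquidistributed

variable [CompleteSpace F] [MeasurableSpace X] [OpensMeasurableSpace X] {ν : Measure X}
  [IsFiniteMeasure ν] {N : ℕ → ℕ} {a : ∀ m, Fin (N m) → X}

theorem tendsto_average_sum_smul (ha : IsEquidistributed ν a) {ι : Type*} (t : Finset ι)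
    {c : ι → X → ℝ} (hc : ∀ i, Continuous (c i)) (y : ι → F) :
    Tendsto (fun m => (N m : ℝ)⁻¹ • ∑ l, ∑ i ∈ t, c i (a m l) • y i) atTop
      (𝓝 ((ν.real Set.univ)⁻¹ • ∫ x, ∑ i ∈ t, c i x • y i ∂ν)) := by
  have hsum (m : ℕ) : (N m : ℝ)⁻¹ • ∑ l, ∑ i ∈ t, c i (a m l) • y i =
      ∑ i ∈ t, ((N m : ℝ)⁻¹ * ∑ l, c i (a m l)) • y i := by
    rw [Finset.sum_comm]
    simp only [Finset.smul_sum, ← Finset.sum_smul, mul_smul]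
  have hint : (ν.real Set.univ)⁻¹ • ∫ x, ∑ i ∈ t, c i x • y i ∂ν =
      ∑ i ∈ t, ((ν.real Set.univ)⁻¹ * ∫ x, c i x ∂ν) • y i := by
    rw [integral_finsetSum _ fun i _ => ((hc i).integrable_of_hasCompactSupport
      (.of_compactSpace _)).smul_const _]
    simp only [integral_smul_const, Finset.smul_sum, mul_smul]
  simp only [hsum, hint]
  exact tendsto_finsetSum _ fun i _ => (ha _ (hc i)).smul_const _

theorem tendsto_average (ha : IsEquidistributed ν a) {G : X → F} (hG : Continuous G) :
    Tendsto (fun m => (N m : ℝ)⁻¹ • ∑ l, G (a m l)) atTop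
      (𝓝 ((ν.real Set.univ)⁻¹ • ∫ x, G x ∂ν)) := by
  rw [Metric.tendsto_nhds]
  intro ε hε
  have hε₃ : 0 < ε / 3 := by positivity
  obtain ⟨t, c, hc, happ⟩ := exists_continuous_norm_sub_sum_smul_le hG hε₃
  set S : X → F := fun x => ∑ i ∈ t, c i x • G i
  have hS : Continuous S := by fun_prop
  have hgrid (m : ℕ) : dist ((N m : ℝ)⁻¹ • ∑ l, G (a m l)) ((N m : ℝ)⁻¹ • ∑ l, S (a m l)) ≤
      ε / 3 := by
    rw [dist_eq_norm, ← smul_sub, ← Finset.sum_sub_distrib]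
    exact norm_inv_smul_sum_le hε₃.le fun l => happ (a m l)
  have hint : dist ((ν.real Set.univ)⁻¹ • ∫ x, S x ∂ν) ((ν.real Set.univ)⁻¹ • ∫ x, G x ∂ν) ≤
      ε / 3 := by
    rw [dist_comm, dist_eq_norm, ← smul_sub, ← integral_sub
      (hG.integrable_of_hasCompactSupport (.of_compactSpace _))
      (hS.integrable_of_hasCompactSupport (.of_compactSpace _))]
    exact norm_inv_measureReal_smul_integral_le hε₃.le happ
  filter_upwards [Metric.tendsto_nhds.1 (ha.tendsto_average_sum_smul t hc fun i => G i) _ hε₃]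
    with m hm
  linarith [hgrid m, dist_triangle4 ((N m : ℝ)⁻¹ • ∑ l, G (a m l))
    ((N m : ℝ)⁻¹ • ∑ l, S (a m l)) ((ν.real Set.univ)⁻¹ • ∫ x, S x ∂ν)
    ((ν.real Set.univ)⁻¹ • ∫ x, G x ∂ν)]

end IsEquidistributed

end Equidistribution

section Eigensystem

variable {N : ℕ} {A : Matrix (Fin N) (Fin N) ℝ} {ℓ : Fin N → ℝ} {v : Fin N → Fin N → ℝ}

namespace IsEigensystem

theorem of_mul_transpose (h : IsEigensystem A ℓ v) : Matrix.of v * (Matrix.of v)ᵀ = 1 := by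
  ext p q
  simpa [Matrix.mul_apply, dotProduct, Matrix.one_apply] using h.orthonormal p q

theorem transpose_mul_of (h : IsEigensystem A ℓ v) : (Matrix.of v)ᵀ * Matrix.of v = 1 :=
  mul_eq_one_comm.1 h.of_mul_transpose

theorem eq_mul_diagonal_mul (h : IsEigensystem A ℓ v) :
    A = (Matrix.of v)ᵀ * Matrix.diagonal ℓ * Matrix.of v := by
  have heigen : A * (Matrix.of v)ᵀ = (Matrix.of v)ᵀ * Matrix.diagonal ℓ := by
    ext i q
    rw [Matrix.mul_diagonal]
    simpa [Matrix.mul_apply, Matrix.mulVec, dotProduct, mul_comm] using congrFun (h.eigen q) i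
  rw [← heigen, Matrix.mul_assoc, h.transpose_mul_of, Matrix.mul_one]

theorem rank_eq (h : IsEigensystem A ℓ v) : A.rank = Fintype.card {p // ℓ p ≠ 0} := by
  have hdet : IsUnit (Matrix.of v).det :=
    (Matrix.isUnit_iff_isUnit_det _).1 (IsUnit.of_mul_eq_one _ h.of_mul_transpose)
  rw [h.eq_mul_diagonal_mul, Matrix.rank_mul_eq_left_of_isUnit_det _ _ hdet,
    Matrix.rank_mul_eq_right_of_isUnit_det _ _ (by rwa [Matrix.det_transpose]),
    Matrix.rank_diagonal]

theorem lt_rank_of_pos (h : IsEigensystem A ℓ v) {q : Fin N} (hq : 0 < ℓ q) : (q : ℕ) < A.rank := by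
  rw [h.rank_eq, Fintype.card_subtype, Nat.lt_iff_add_one_le, ← Fin.card_Iic]
  refine Finset.card_le_card fun p hp => Finset.mem_filter_univ _ |>.2 ?_
  exact (hq.trans_le (h.antitone (Finset.mem_Iic.1 hp))).ne'

theorem sum_dotProduct_sq (h : IsEigensystem A ℓ v) (y : Fin N → ℝ) :
    ∑ p, (v p ⬝ᵥ y) ^ 2 = y ⬝ᵥ y := by
  calc ∑ p, (v p ⬝ᵥ y) ^ 2 = (Matrix.of v *ᵥ y) ⬝ᵥ (Matrix.of v *ᵥ y) := by
        simp [dotProduct, Matrix.mulVec, sq]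
    _ = y ⬝ᵥ y := by
        rw [Matrix.dotProduct_mulVec, Matrix.vecMul_mulVec, h.transpose_mul_of, Matrix.vecMul_one]

end IsEigensystem

end Eigensystem

section FrameOperator

variable {H : Type*} [NormedAddCommGroup H] [InnerProductSpace ℝ H]

/-- The frame operator `∑ l, ψ l ⊗ ψ l` of a finite family; it has the same nonzero eigenvalues as
the Gram matrix of the family. -/
noncomputable def frameOperator {κ : Type*} [Fintype κ] (ψ : κ → H) : H →L[ℝ] H :=
  ∑ l, InnerProductSpace.rankOne ℝ (ψ l) (ψ l)

/-- The unit eigenvector of the frame operator of `ψ` that corresponds to the eigenpair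
`(ℓ q, v q)` of the Gram matrix; it is `0` if `ℓ q = 0`. -/
noncomputable def frameEigenvector {N : ℕ} (ψ : Fin N → H) (ℓ : Fin N → ℝ)
    (v : Fin N → Fin N → ℝ) (q : Fin N) : H :=
  (√(ℓ q))⁻¹ • Fintype.linearCombination ℝ ψ (v q)

section

variable {κ : Type*} [Fintype κ] (ψ : κ → H)

theorem inner_linearCombination_left (β : κ → ℝ) (x : H) :
    ⟪Fintype.linearCombination ℝ ψ β, x⟫_ℝ = β ⬝ᵥ fun l => ⟪ψ l, x⟫_ℝ := by
  simp [Fintype.linearCombination_apply, sum_inner, inner_smul_left, dotProduct]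

theorem inner_linearCombination_right (β : κ → ℝ) :
    (fun l => ⟪ψ l, Fintype.linearCombination ℝ ψ β⟫_ℝ) = Matrix.gram ℝ ψ *ᵥ β := by
  ext l
  simp [Fintype.linearCombination_apply, inner_sum, inner_smul_right, Matrix.mulVec, dotProduct,
    Matrix.gram_apply, mul_comm]

theorem frameOperator_apply (x : H) :
    frameOperator ψ x = Fintype.linearCombination ℝ ψ fun l => ⟪ψ l, x⟫_ℝ := by
  simp [frameOperator, Fintype.linearCombination_apply, _root_.sum_apply]

theorem frameOperator_linearCombination (β : κ → ℝ) :
    frameOperator ψ (Fintype.linearCombination ℝ ψ β) =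
      Fintype.linearCombination ℝ ψ (Matrix.gram ℝ ψ *ᵥ β) := by
  rw [frameOperator_apply, inner_linearCombination_right]

end

namespace IsEigensystem

variable {N : ℕ} {ψ : Fin N → H} {ℓ : Fin N → ℝ} {v : Fin N → Fin N → ℝ}

theorem inner_linearCombination (h : IsEigensystem (Matrix.gram ℝ ψ) ℓ v) (q : Fin N)
    (β : Fin N → ℝ) :
    ⟪Fintype.linearCombination ℝ ψ (v q), Fintype.linearCombination ℝ ψ β⟫_ℝ =
      ℓ q * (v q ⬝ᵥ β) := by
  rw [real_inner_comm, inner_linearCombination_left, inner_linearCombination_right, h.eigen,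
    dotProduct_smul, smul_eq_mul, dotProduct_comm]

theorem eigenvalue_nonneg (h : IsEigensystem (Matrix.gram ℝ ψ) ℓ v) (q : Fin N) : 0 ≤ ℓ q := by
  have hq := h.inner_linearCombination q (v q)
  rw [h.orthonormal, if_pos rfl, mul_one] at hq
  exact hq ▸ real_inner_self_nonneg

theorem sqrt_smul_frameEigenvector (h : IsEigensystem (Matrix.gram ℝ ψ) ℓ v) (q : Fin N) :
    √(ℓ q) • frameEigenvector ψ ℓ v q = Fintype.linearCombination ℝ ψ (v q) := by
  rw [frameEigenvector, smul_smul]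
  rcases (h.eigenvalue_nonneg q).eq_or_lt with hq | hq
  · have hzero := h.inner_linearCombination q (v q)
    rw [← hq, zero_mul, inner_self_eq_zero] at hzero
    rw [hzero, smul_zero]
  · rw [mul_inv_cancel₀ (Real.sqrt_pos.2 hq).ne', one_smul]

theorem inner_frameEigenvector_linearCombination (h : IsEigensystem (Matrix.gram ℝ ψ) ℓ v)
    (q : Fin N) (β : Fin N → ℝ) :
    ⟪frameEigenvector ψ ℓ v q, Fintype.linearCombination ℝ ψ β⟫_ℝ = √(ℓ q) * (v q ⬝ᵥ β) := by
  rw [frameEigenvector, real_inner_smul_left, h.inner_linearCombination, ← mul_assoc,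
    inv_mul_eq_div, Real.div_sqrt]

theorem frameOperator_frameEigenvector (h : IsEigensystem (Matrix.gram ℝ ψ) ℓ v) (q : Fin N) :
    frameOperator ψ (frameEigenvector ψ ℓ v q) = ℓ q • frameEigenvector ψ ℓ v q := by
  rw [frameEigenvector, map_smul, frameOperator_linearCombination, h.eigen, map_smul, smul_comm]

theorem orthonormal_frameEigenvector (h : IsEigensystem (Matrix.gram ℝ ψ) ℓ v) :
    Orthonormal ℝ fun q : {q // ℓ q ≠ 0} => frameEigenvector ψ ℓ v q := by
  rw [orthonormal_iff_ite]
  rintro ⟨p, hp⟩ ⟨q, hq⟩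
  have hsqrt : √(ℓ q) ≠ 0 := (Real.sqrt_pos.2 ((h.eigenvalue_nonneg q).lt_of_ne' hq)).ne'
  have hinner := h.inner_frameEigenvector_linearCombination p (v q)
  rw [← h.sqrt_smul_frameEigenvector, real_inner_smul_right, h.orthonormal] at hinner
  refine mul_left_cancel₀ hsqrt (hinner.trans ?_)
  rcases eq_or_ne p q with rfl | hpq <;> simp [*]

theorem inner_frameOperator (h : IsEigensystem (Matrix.gram ℝ ψ) ℓ v) (x : H) :
    ⟪x, frameOperator ψ x⟫_ℝ = ∑ q, ℓ q * ⟪frameEigenvector ψ ℓ v q, x⟫_ℝ ^ 2 := by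
  rw [real_inner_comm, frameOperator_apply, inner_linearCombination_left, ← h.sum_dotProduct_sq]
  refine Finset.sum_congr rfl fun q _ => ?_
  rw [← inner_linearCombination_left, ← h.sqrt_smul_frameEigenvector, real_inner_smul_left, mul_pow,
    Real.sq_sqrt (h.eigenvalue_nonneg q)]

theorem extend_nonneg (h : IsEigensystem (Matrix.gram ℝ ψ) ℓ v) :
    0 ≤ Function.extend Fin.val ℓ 0 :=
  Function.extend_nonneg h.eigenvalue_nonneg le_rfl

theorem antitone_extend (h : IsEigensystem (Matrix.gram ℝ ψ) ℓ v) :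
    Antitone (Function.extend Fin.val ℓ 0) := by
  intro p q hpq
  by_cases hq : q < N
  · lift q to Fin N using hq
    lift p to Fin N using hpq.trans_lt q.2
    simpa only [Fin.val_injective.extend_apply] using h.antitone hpq
  · rw [Function.extend_apply' _ _ q fun ⟨i, hi⟩ => hq (hi ▸ i.2)]
    exact h.extend_nonneg p

theorem orthonormal_extend (h : IsEigensystem (Matrix.gram ℝ ψ) ℓ v) :
    Orthonormal ℝ fun q : NonzeroIndex (Function.extend Fin.val ℓ 0) =>
      Function.extend Fin.val (frameEigenvector ψ ℓ v) 0 q := by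
  have hval (q : NonzeroIndex (Function.extend Fin.val ℓ 0)) : ∃ p : Fin N, p = (q : ℕ) := by
    by_contra hq
    exact q.2 (Function.extend_apply' _ _ _ hq)
  choose f hf using hval
  have hℓ (q) : ℓ (f q) ≠ 0 := by
    simpa only [← hf q, Fin.val_injective.extend_apply] using q.2
  have hinj : Function.Injective fun q => (⟨f q, hℓ q⟩ : {p // ℓ p ≠ 0}) := by
    intro p q hpq
    rw [Subtype.ext_iff, ← hf p, ← hf q, show f p = f q from congrArg Subtype.val hpq]
  convert h.orthonormal_frameEigenvector.comp _ hinj using 2 with q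
  rw [Function.comp_apply, ← hf q, Fin.val_injective.extend_apply]

theorem isEigenexpansion (h : IsEigensystem (Matrix.gram ℝ ψ) ℓ v) :
    IsEigenexpansion (frameOperator ψ) (Function.extend Fin.val ℓ 0)
      (Function.extend Fin.val (frameEigenvector ψ ℓ v) 0) where
  antitone := h.antitone_extend
  nonneg := h.extend_nonneg
  orthonormal := h.orthonormal_extend
  hasSum_inner x := by
    rw [h.inner_frameOperator]
    refine ((Fin.val_injective (n := N)).hasSum_iff fun q hq => ?_).1 ?_
    · rw [Function.extend_apply' _ _ _ hq, Pi.zero_apply, zero_mul]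
    · simp only [Function.comp_def, Fin.val_injective.extend_apply]
      exact hasSum_fintype _

end IsEigensystem

theorem rank_gram_le_card {κ ι : Type*} [Fintype κ] [Fintype ι] (b : HilbertBasis ι ℝ H)
    (ψ : κ → H) : (Matrix.gram ℝ ψ).rank ≤ Fintype.card ι := by
  have hmul : Matrix.gram ℝ ψ = (Matrix.of fun i p => ⟪ψ i, b p⟫_ℝ) *
      Matrix.of fun p j => ⟪b p, ψ j⟫_ℝ := by
    ext i j
    exact (b.hasSum_inner_mul_inner (ψ i) (ψ j)).unique (hasSum_fintype _)
  rw [hmul]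
  exact (Matrix.rank_mul_le_left _ _).trans (Matrix.rank_le_card_width _)

theorem ne_zero_of_lt_rank_gram {κ : Type*} [Fintype κ] {α : ℕ → ℝ} (hα : Antitone α)
    (hα₀ : ∀ q, 0 ≤ α q) (b : HilbertBasis (NonzeroIndex α) ℝ H) (ψ : κ → H) {q : ℕ}
    (hq : q < (Matrix.gram ℝ ψ).rank) : α q ≠ 0 := by
  intro hzero
  have hlt (p : NonzeroIndex α) : (p : ℕ) < q := by
    by_contra! hqp
    exact p.2 (le_antisymm ((hα hqp).trans hzero.le) (hα₀ p))
  let f : NonzeroIndex α → Fin q := fun p => ⟨p, hlt p⟩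
  have hf : Function.Injective f := fun p p' h => Subtype.ext (Fin.mk.inj h)
  have := Fintype.ofInjective f hf
  exact hq.not_ge ((rank_gram_le_card b ψ).trans (by simpa using Fintype.card_le_of_injective f hf))

end FrameOperator

section FeatureMap

variable {X H : Type*} [NormedAddCommGroup H] [InnerProductSpace ℝ H]

/-- The kernel of a feature map `φ : X → H`. -/
def featureKernel (φ : X → H) (x y : X) : ℝ := ⟪φ x, φ y⟫_ℝ

variable {α : ℕ → ℝ} {b : HilbertBasis (NonzeroIndex α) ℝ H}

theorem hasSum_inner_extend_smul (b : HilbertBasis (NonzeroIndex α) ℝ H) (h : H) :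
    HasSum (fun q : ℕ => ⟪Function.extend Subtype.val b 0 q, h⟫_ℝ •
      (Function.extend Subtype.val b 0 q : H)) h := by
  refine ((Subtype.val_injective (p := fun q => α q ≠ 0)).hasSum_iff fun q hq => ?_).1 ?_
  · rw [Function.extend_apply' _ _ _ hq, Pi.zero_apply, smul_zero]
  · simpa only [Function.comp_def, Subtype.val_injective.extend_apply, b.repr_apply_apply]
      using b.hasSum_repr h

/-- The normalized eigenfunctions `x ↦ ⟪φ x, b q⟫ / √(α q)` of the integral operator of
`featureKernel φ` that correspond to an eigenbasis `b` of the covariance operator of `φ`. They are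
indexed by all of `ℕ`, as in `IsSpectralDecomposition`, and are `0` where `α q = 0`. -/
noncomputable def eigenfunction (φ : X → H) (b : HilbertBasis (NonzeroIndex α) ℝ H) (q : ℕ)
    (x : X) : ℝ :=
  (√(α q))⁻¹ * ⟪φ x, Function.extend Subtype.val b 0 q⟫_ℝ

theorem sqrt_mul_eigenfunction (hα₀ : ∀ q, 0 ≤ α q) (φ : X → H)
    (b : HilbertBasis (NonzeroIndex α) ℝ H) (q : NonzeroIndex α) (x : X) :
    √(α q) * eigenfunction φ b q x = ⟪φ x, b q⟫_ℝ := by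
  have hsqrt : √(α q) ≠ 0 := (Real.sqrt_pos.2 ((hα₀ q).lt_of_ne' q.2)).ne'
  rw [eigenfunction, mul_inv_cancel_left₀ hsqrt, Subtype.val_injective.extend_apply]

theorem continuous_eigenfunction [TopologicalSpace X] {φ : X → H} (hφ : Continuous φ)
    (b : HilbertBasis (NonzeroIndex α) ℝ H) (q : ℕ) : Continuous (eigenfunction φ b q) := by
  unfold eigenfunction
  fun_prop

theorem eigenfunction_eq (hα₀ : ∀ q, 0 ≤ α q) {φ : X → H} {q : NonzeroIndex α} {f : X → ℝ}
    (hf : ∀ x, ⟪φ x, b q⟫_ℝ = √(α q) * f x) : eigenfunction φ b q = f := by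
  have hsqrt : √(α q) ≠ 0 := (Real.sqrt_pos.2 ((hα₀ q).lt_of_ne' q.2)).ne'
  ext x
  exact mul_left_cancel₀ hsqrt ((sqrt_mul_eigenfunction hα₀ φ b q x).trans (hf x))

theorem IsEigenbasis.eigenfunction_eq_or_eq_neg {A : H →L[ℝ] H}
    {b' : HilbertBasis (NonzeroIndex α) ℝ H}
    (hb : IsEigenbasis A (fun q : NonzeroIndex α => α q) b)
    (hb' : IsEigenbasis A (fun q : NonzeroIndex α => α q) b') (φ : X → H) {q : NonzeroIndex α}
    (hq : ∀ p : ℕ, p ≠ q → α p ≠ α q) :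
    eigenfunction φ b' q = eigenfunction φ b q ∨ eigenfunction φ b' q = -eigenfunction φ b q := by
  have hsign : b' q = b q ∨ b' q = -b q :=
    hb.eq_or_eq_neg (fun p hp => hq p (Subtype.coe_injective.ne hp)) (hb' q) (b'.orthonormal.1 q)
  refine hsign.imp (fun h => ?_) fun h => ?_
  all_goals
    ext x
    simp [eigenfunction, h]

theorem continuous_rankOne_self [TopologicalSpace X] {φ : X → H} (hφ : Continuous φ) :
    Continuous fun y => InnerProductSpace.rankOne ℝ (φ y) (φ y) :=
  ((InnerProductSpace.rankOne ℝ).continuous.comp hφ).clm_apply hφ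

variable [MeasurableSpace X]

/-- The synthesis operator `f ↦ ∫ f(y) φ(y) dν(y)` of a feature map `φ`. -/
noncomputable def synthesis (ν : Measure X) (φ : X → H) (f : X → ℝ) : H := ∫ y, f y • φ y ∂ν

/-- The (uncentred) covariance operator `∫ φ(y) ⊗ φ(y) dν(y)` of a feature map `φ`; it has the same
nonzero eigenvalues as the integral operator of `featureKernel φ`. -/
noncomputable def covariance (ν : Measure X) (φ : X → H) : H →L[ℝ] H :=
  ∫ y, InnerProductSpace.rankOne ℝ (φ y) (φ y) ∂ν

theorem synthesis_const_mul (ν : Measure X) (φ : X → H) (c : ℝ) (f : X → ℝ) :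
    synthesis ν φ (fun y => c * f y) = c • synthesis ν φ f := by
  simp only [synthesis, mul_smul, integral_smul]

theorem tendsto_eLpNorm_inner {κ : Type*} {l : Filter κ} {ν : Measure X} {φ : X → H}
    {p : ENNReal} (hφ : MemLp φ p ν) {h : κ → H} (hh : Tendsto h l (𝓝 0)) :
    Tendsto (fun m => eLpNorm (fun x => ⟪φ x, h m⟫_ℝ) p ν) l (𝓝 0) := by
  have hbound (m : κ) : eLpNorm (fun x => ⟪φ x, h m⟫_ℝ) p ν ≤
      ENNReal.ofReal ‖h m‖ * eLpNorm φ p ν :=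
    eLpNorm_le_mul_eLpNorm_of_ae_le_mul (Eventually.of_forall fun x => by
      rw [mul_comm]
      exact norm_inner_le_norm _ _) p
  refine tendsto_of_tendsto_of_tendsto_of_le_of_le tendsto_const_nhds ?_ (fun _ => zero_le) hbound
  simpa using ENNReal.Tendsto.mul_const (ENNReal.tendsto_ofReal hh.norm) (Or.inr hφ.eLpNorm_ne_top)

theorem IsSpectralDecomposition.integrable {ν : Measure X} [IsFiniteMeasure ν] {k : X → X → ℝ}
    {ev : ℕ → ℝ} {e : ℕ → X → ℝ} (hspec : IsSpectralDecomposition ν k ev e) {q : ℕ}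
    (hq : ev q ≠ 0) : Integrable (e q) ν :=
  (hspec.memLp q hq).integrable one_le_two

variable [TopologicalSpace X] [CompactSpace X] [OpensMeasurableSpace X] {ν : Measure X}
  [IsFiniteMeasure ν] {φ : X → H}

theorem integrable_smul_of_continuous (hφ : Continuous φ) {f : X → ℝ} (hf : Integrable f ν) :
    Integrable (fun y => f y • φ y) ν :=
  hf.smul_of_top_left (hφ.memLp_of_hasCompactSupport (.of_compactSpace _))

theorem covariance_apply (hφ : Continuous φ) (h : H) :
    covariance ν φ h = synthesis ν φ fun y => ⟪φ y, h⟫_ℝ := by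
  rw [covariance, ContinuousLinearMap.integral_apply
    ((continuous_rankOne_self hφ).integrable_of_hasCompactSupport (.of_compactSpace _))]
  rfl

theorem IsEigenbasis.synthesis_eigenfunction
    (hb : IsEigenbasis (covariance ν φ) (fun q : NonzeroIndex α => α q) b)
    (hφ : Continuous φ) (hα₀ : ∀ q, 0 ≤ α q) (q : NonzeroIndex α) :
    synthesis ν φ (eigenfunction φ b q) = √(α q) • b q := by
  have hsqrt : √(α q) ≠ 0 := (Real.sqrt_pos.2 ((hα₀ q).lt_of_ne' q.2)).ne'
  have hq := hb q
  simp only [covariance_apply hφ, ← sqrt_mul_eigenfunction hα₀, synthesis_const_mul] at hq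
  refine smul_right_injective H hsqrt (hq.trans ?_)
  simp only [smul_smul, Real.mul_self_sqrt (hα₀ q)]

variable [CompleteSpace H]

theorem inner_synthesis (hφ : Continuous φ) {f : X → ℝ} (hf : Integrable f ν) (h : H) :
    ⟪h, synthesis ν φ f⟫_ℝ = ∫ y, f y * ⟪φ y, h⟫_ℝ ∂ν := by
  rw [synthesis, ← integral_inner (integrable_smul_of_continuous hφ hf)]
  simp only [inner_smul_right, real_inner_comm]

theorem integralOperator_featureKernel (hφ : Continuous φ) {f : X → ℝ} (hf : Integrable f ν)
    (x : X) : integralOperator ν (featureKernel φ) f x = ⟪φ x, synthesis ν φ f⟫_ℝ := by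
  rw [inner_synthesis hφ hf, integralOperator]
  simp only [featureKernel, real_inner_comm, mul_comm]

theorem inner_covariance (hφ : Continuous φ) (g h : H) :
    ⟪g, covariance ν φ h⟫_ℝ = ∫ y, ⟪φ y, h⟫_ℝ * ⟪φ y, g⟫_ℝ ∂ν := by
  have hc : Continuous fun y => ⟪φ y, h⟫_ℝ := by fun_prop
  rw [covariance_apply hφ,
    inner_synthesis hφ (hc.integrable_of_hasCompactSupport (.of_compactSpace _))]

theorem inner_eq_zero_of_covariance_apply_eq_zero [ν.IsOpenPosMeasure] (hφ : Continuous φ) {h : H}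
    (hh : covariance ν φ h = 0) (x : X) : ⟪φ x, h⟫_ℝ = 0 := by
  have hc : Continuous fun y => ⟪φ y, h⟫_ℝ * ⟪φ y, h⟫_ℝ := by fun_prop
  have hint : ∫ y, ⟪φ y, h⟫_ℝ * ⟪φ y, h⟫_ℝ ∂ν = 0 := by
    rw [← inner_covariance hφ, hh, inner_zero_right]
  rw [integral_eq_zero_iff_of_nonneg (fun y => mul_self_nonneg _)
    (hc.integrable_of_hasCompactSupport (.of_compactSpace _)),
    hc.ae_eq_iff_eq ν continuous_zero] at hint
  exact mul_self_eq_zero.1 (congrFun hint x)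

theorem integral_eigenfunction_mul (hφ : Continuous φ) (hα₀ : ∀ q, 0 ≤ α q)
    {f : X → ℝ} (hf : Integrable f ν) (q : NonzeroIndex α) :
    √(α q) * ∫ y, eigenfunction φ b q y * f y ∂ν = ⟪b q, synthesis ν φ f⟫_ℝ := by
  rw [inner_synthesis hφ hf, ← integral_const_mul]
  congr 1
  ext y
  rw [← sqrt_mul_eigenfunction hα₀]
  ring

theorem tendsto_eLpNorm_integralOperator_sub_sum (hφ : Continuous φ) (hα₀ : ∀ q, 0 ≤ α q)
    (b : HilbertBasis (NonzeroIndex α) ℝ H) {f : X → ℝ} (hf : Integrable f ν) (p : ENNReal) :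
    Tendsto (fun Q : ℕ => eLpNorm (fun x => integralOperator ν (featureKernel φ) f x -
      ∑ q ∈ Finset.range Q, α q * (∫ y, eigenfunction φ b q y * f y ∂ν) * eigenfunction φ b q x)
        p ν) atTop (𝓝 0) := by
  have hterm (q : ℕ) (x : X) : α q * (∫ y, eigenfunction φ b q y * f y ∂ν) *
      eigenfunction φ b q x = ⟪φ x, ⟪Function.extend Subtype.val b 0 q, synthesis ν φ f⟫_ℝ •
        (Function.extend Subtype.val b 0 q : H)⟫_ℝ := by
    by_cases hq : α q = 0
    · rw [Function.extend_apply' _ _ _ fun ⟨p, hp⟩ => p.2 (hp ▸ hq)]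
      simp [hq]
    · lift q to NonzeroIndex α using hq
      rw [Subtype.val_injective.extend_apply, real_inner_smul_right,
        ← sqrt_mul_eigenfunction hα₀, ← integral_eigenfunction_mul hφ hα₀ hf]
      nth_rewrite 1 [← Real.mul_self_sqrt (hα₀ q)]
      ring
  simp only [hterm, integralOperator_featureKernel hφ hf, ← inner_sum, ← inner_sub_right]
  refine tendsto_eLpNorm_inner (hφ.memLp_of_hasCompactSupport (.of_compactSpace _)) ?_
  rw [← sub_self (synthesis ν φ f)]
  exact tendsto_const_nhds.sub (hasSum_inner_extend_smul b (synthesis ν φ f)).tendsto_sum_nat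

namespace IsSpectralDecomposition

variable {ev : ℕ → ℝ} {e : ℕ → X → ℝ} {q : ℕ}

theorem inner_synthesis_eigenfunction (hspec : IsSpectralDecomposition ν (featureKernel φ) ev e)
    (hφ : Continuous φ) (hq : ev q ≠ 0) (x : X) :
    ⟪φ x, synthesis ν φ (e q)⟫_ℝ = ev q * e q x := by
  rw [← integralOperator_featureKernel hφ (hspec.integrable hq), hspec.eigen q hq]

theorem inner_synthesis_synthesis (hspec : IsSpectralDecomposition ν (featureKernel φ) ev e)
    (hφ : Continuous φ) {p : ℕ} (hp : ev p ≠ 0) (hq : ev q ≠ 0) :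
    ⟪synthesis ν φ (e p), synthesis ν φ (e q)⟫_ℝ = ev p * if p = q then 1 else 0 := by
  rw [inner_synthesis hφ (hspec.integrable hq), ← hspec.orthonormal p q hp hq,
    ← integral_const_mul]
  simp only [hspec.inner_synthesis_eigenfunction hφ hp, mul_comm, mul_left_comm]

theorem eigenvalue_nonneg (hspec : IsSpectralDecomposition ν (featureKernel φ) ev e)
    (hφ : Continuous φ) (q : ℕ) : 0 ≤ ev q := by
  by_cases hq : ev q = 0
  · exact hq.ge
  · have hinner := hspec.inner_synthesis_synthesis hφ hq hq
    rw [if_pos rfl, mul_one] at hinner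
    exact hinner ▸ real_inner_self_nonneg

theorem sqrt_pos (hspec : IsSpectralDecomposition ν (featureKernel φ) ev e) (hφ : Continuous φ)
    (hq : ev q ≠ 0) : 0 < √(ev q) :=
  Real.sqrt_pos.2 ((hspec.eigenvalue_nonneg hφ q).lt_of_ne' hq)

theorem orthonormal_synthesis (hspec : IsSpectralDecomposition ν (featureKernel φ) ev e)
    (hφ : Continuous φ) :
    Orthonormal ℝ fun q : NonzeroIndex ev => (√(ev q))⁻¹ • synthesis ν φ (e q) := by
  rw [orthonormal_iff_ite]
  intro p q
  rw [real_inner_smul_left, real_inner_smul_right,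
    hspec.inner_synthesis_synthesis hφ p.2 q.2]
  rcases eq_or_ne p q with rfl | hpq
  · have hsqrt := (hspec.sqrt_pos hφ p.2).ne'
    nth_rewrite 3 [← Real.mul_self_sqrt (hspec.eigenvalue_nonneg hφ p)]
    rw [if_pos rfl, if_pos rfl]
    field_simp
  · rw [if_neg (Subtype.coe_injective.ne hpq), if_neg hpq]
    ring

theorem inner_inv_sqrt_smul_synthesis (hspec : IsSpectralDecomposition ν (featureKernel φ) ev e)
    (hφ : Continuous φ) (hq : ev q ≠ 0) (x : X) :
    ⟪φ x, (√(ev q))⁻¹ • synthesis ν φ (e q)⟫_ℝ = √(ev q) * e q x := by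
  rw [real_inner_smul_right, hspec.inner_synthesis_eigenfunction hφ hq, ← mul_assoc, inv_mul_eq_div,
    Real.div_sqrt]

theorem covariance_synthesis (hspec : IsSpectralDecomposition ν (featureKernel φ) ev e)
    (hφ : Continuous φ) (hq : ev q ≠ 0) :
    covariance ν φ (synthesis ν φ (e q)) = ev q • synthesis ν φ (e q) := by
  simp only [covariance_apply hφ, hspec.inner_synthesis_eigenfunction hφ hq, synthesis_const_mul]

theorem synthesis_eq_zero (hspec : IsSpectralDecomposition ν (featureKernel φ) ev e)
    (hφ : Continuous φ) {f : X → ℝ} (hf : MemLp f 2 ν)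
    (hcoeff : ∀ q, ev q ≠ 0 → ∫ y, e q y * f y ∂ν = 0) : synthesis ν φ f = 0 := by
  have hfi : Integrable f ν := hf.integrable one_le_two
  have hc : Continuous fun x => ⟪φ x, synthesis ν φ f⟫_ℝ := by fun_prop
  have hpartial (Q : ℕ) (x : X) : ∑ q ∈ Finset.range Q, ev q * (∫ y, e q y * f y ∂ν) * e q x = 0 :=
    Finset.sum_eq_zero fun q _ => by
      by_cases hq : ev q = 0
      · rw [hq, zero_mul, zero_mul]
      · rw [hcoeff q hq, mul_zero, zero_mul]
  have hlim := hspec.decomposition f hf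
  simp only [hpartial, sub_zero, integralOperator_featureKernel hφ hfi] at hlim
  have hae : (fun x => ⟪φ x, synthesis ν φ f⟫_ℝ) =ᵐ[ν] 0 :=
    (eLpNorm_eq_zero_iff (hc.stronglyMeasurable_of_hasCompactSupport
      (.of_compactSpace _)).aestronglyMeasurable two_ne_zero).1
      (tendsto_nhds_unique tendsto_const_nhds hlim)
  rw [← inner_self_eq_zero (𝕜 := ℝ), inner_synthesis hφ hfi]
  refine integral_eq_zero_of_ae ?_
  filter_upwards [hae] with x hx
  simp only [hx, Pi.zero_apply, mul_zero]

theorem exists_hilbertBasis [ν.IsOpenPosMeasure]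
    (hspec : IsSpectralDecomposition ν (featureKernel φ) ev e) (hφ : Continuous φ)
    (htotal : ∀ h : H, (∀ x, ⟪φ x, h⟫_ℝ = 0) → h = 0) :
    ∃ b : HilbertBasis (NonzeroIndex ev) ℝ H, (∀ q x, ⟪φ x, b q⟫_ℝ = √(ev q) * e q x) ∧
      IsEigenbasis (covariance ν φ) (fun q : NonzeroIndex ev => ev q) b := by
  have hcomplete : (Submodule.span ℝ (Set.range fun q : NonzeroIndex ev =>
      (√(ev q))⁻¹ • synthesis ν φ (e q)))ᗮ = ⊥ := by
    refine (Submodule.eq_bot_iff _).2 fun h hh => htotal h ?_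
    refine inner_eq_zero_of_covariance_apply_eq_zero (ν := ν) hφ ?_
    have hc : Continuous fun y => ⟪φ y, h⟫_ℝ := by fun_prop
    rw [covariance_apply hφ]
    refine hspec.synthesis_eq_zero hφ
      (hc.memLp_of_hasCompactSupport (.of_compactSpace _)) fun q hq => ?_
    have horth := (Submodule.mem_orthogonal' _ _).1 hh _ (Submodule.subset_span ⟨⟨q, hq⟩, rfl⟩)
    rw [real_inner_smul_right, inner_synthesis hφ (hspec.integrable hq)] at horth
    exact (mul_eq_zero.1 horth).resolve_left (inv_ne_zero (hspec.sqrt_pos hφ hq).ne')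
  refine ⟨HilbertBasis.mkOfOrthogonalEqBot (hspec.orthonormal_synthesis hφ) hcomplete,
    fun q x => ?_, fun q => ?_⟩
  · rw [HilbertBasis.coe_mkOfOrthogonalEqBot, hspec.inner_inv_sqrt_smul_synthesis hφ q.2]
  · rw [HilbertBasis.coe_mkOfOrthogonalEqBot, map_smul, hspec.covariance_synthesis hφ q.2,
      smul_comm]

end IsSpectralDecomposition

namespace IsEigenbasis

theorem summable {ι : Type*} {Λ : ι → ℝ} {b : HilbertBasis ι ℝ H}
    (hb : IsEigenbasis (covariance ν φ) Λ b) (hφ : Continuous φ) (hΛ : ∀ q, 0 ≤ Λ q) :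
    Summable Λ := by
  have hint {f : X → ℝ} (hf : Continuous f) : Integrable f ν :=
    hf.integrable_of_hasCompactSupport (.of_compactSpace _)
  have htrace (q : ι) : Λ q = ∫ x, ‖⟪b q, φ x⟫_ℝ‖ ^ 2 ∂ν := by
    have hinner := inner_covariance (ν := ν) hφ (b q) (b q)
    rw [hb q, real_inner_smul_right, real_inner_self_eq_norm_sq, b.orthonormal.1, one_pow,
      mul_one] at hinner
    simp only [hinner, Real.norm_eq_abs, sq_abs, ← sq, real_inner_comm]
  refine summable_of_sum_le (c := ∫ x, ‖φ x‖ ^ 2 ∂ν) hΛ fun s => ?_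
  rw [Finset.sum_congr rfl fun q _ => htrace q,
    ← integral_finsetSum _ fun q _ => hint (by fun_prop)]
  exact integral_mono (hint (by fun_prop)) (hint (by fun_prop)) fun x =>
    b.orthonormal.sum_inner_products_le (φ x)

theorem isSpectralDecomposition
    (hb : IsEigenbasis (covariance ν φ) (fun q : NonzeroIndex α => α q) b)
    (hφ : Continuous φ) (hα : Antitone α) (hα₀ : ∀ q, 0 ≤ α q) :
    IsSpectralDecomposition ν (featureKernel φ) α (eigenfunction φ b) where
  antitone := hα
  memLp q _ := (continuous_eigenfunction hφ b q).memLp_of_hasCompactSupport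
    (.of_compactSpace _)
  eigen q hq x := by
    lift q to NonzeroIndex α using hq
    rw [integralOperator_featureKernel hφ ((continuous_eigenfunction hφ b
      q).integrable_of_hasCompactSupport (.of_compactSpace _)),
      hb.synthesis_eigenfunction hφ hα₀, real_inner_smul_right, ← sqrt_mul_eigenfunction hα₀,
      ← mul_assoc, Real.mul_self_sqrt (hα₀ q)]
  orthonormal p q hp hq := by
    lift p to NonzeroIndex α using hp
    lift q to NonzeroIndex α using hq
    have hsqrt : √(α p) ≠ 0 := (Real.sqrt_pos.2 ((hα₀ p).lt_of_ne' p.2)).ne'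
    refine mul_left_cancel₀ hsqrt ?_
    rw [integral_eigenfunction_mul hφ hα₀ ((continuous_eigenfunction hφ b
      q).integrable_of_hasCompactSupport (.of_compactSpace _)),
      hb.synthesis_eigenfunction hφ hα₀, real_inner_smul_right,
      orthonormal_iff_ite.1 b.orthonormal]
    rcases eq_or_ne p q with rfl | hpq
    · simp
    · simp [hpq, Subtype.coe_injective.ne hpq]
  decomposition f hf :=
    tendsto_eLpNorm_integralOperator_sub_sum hφ hα₀ b (hf.integrable one_le_two) 2

end IsEigenbasis

end FeatureMap

section FrameOperatorLimit

variable {κ H : Type*} [NormedAddCommGroup H] [InnerProductSpace ℝ H] {l : Filter κ} {N : κ → ℕ}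
  {ψ : ∀ m, Fin (N m) → H} {ℓ : ∀ m, Fin (N m) → ℝ} {v : ∀ m, Fin (N m) → Fin (N m) → ℝ}
  {c : κ → ℝ} {A : H →L[ℝ] H} {α : ℕ → ℝ}

namespace IsEigenexpansion

variable {u : ℕ → H}

theorem tendsto_eigenvalue (hA : IsEigenexpansion A α u)
    (hv : ∀ m, IsEigensystem (Matrix.gram ℝ (ψ m)) (ℓ m) (v m)) (hc : ∀ m, 0 ≤ c m)
    (hlim : Tendsto (fun m => c m • frameOperator (ψ m)) l (𝓝 A)) (q : ℕ) :
    Tendsto (fun m => c m * Function.extend Fin.val (ℓ m) 0 q) l (𝓝 (α q)) := by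
  rw [tendsto_iff_norm_sub_tendsto_zero] at hlim ⊢
  exact squeeze_zero_norm' (Eventually.of_forall fun m => by
    simpa using ((hv m).isEigenexpansion.smul (hc m)).abs_sub_le hA q) hlim

theorem eventually_exists_eigenvalue_pos (hA : IsEigenexpansion A α u)
    (hv : ∀ m, IsEigensystem (Matrix.gram ℝ (ψ m)) (ℓ m) (v m)) (hc : ∀ m, 0 ≤ c m)
    (hlim : Tendsto (fun m => c m • frameOperator (ψ m)) l (𝓝 A)) {q : ℕ} (hq : α q ≠ 0) :
    ∀ᶠ m in l, ∃ i : Fin (N m), i = q ∧ 0 < ℓ m i := by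
  filter_upwards [(hA.tendsto_eigenvalue hv hc hlim q).eventually_const_lt
    ((hA.nonneg q).lt_of_ne' hq)] with m hm
  have hpos := pos_of_mul_pos_right hm (hc m)
  by_cases hqN : ∃ i : Fin (N m), i = q
  · obtain ⟨i, rfl⟩ := hqN
    exact ⟨i, rfl, by rwa [Fin.val_injective.extend_apply] at hpos⟩
  · rw [Function.extend_apply' _ _ _ hqN] at hpos
    exact absurd hpos (lt_irrefl 0)

theorem eventually_lt_rank (hA : IsEigenexpansion A α u)
    (hv : ∀ m, IsEigensystem (Matrix.gram ℝ (ψ m)) (ℓ m) (v m)) (hc : ∀ m, 0 ≤ c m)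
    (hlim : Tendsto (fun m => c m • frameOperator (ψ m)) l (𝓝 A)) {q : ℕ} (hq : α q ≠ 0) :
    ∀ᶠ m in l, q < (Matrix.gram ℝ (ψ m)).rank := by
  filter_upwards [hA.eventually_exists_eigenvalue_pos hv hc hlim hq] with m ⟨i, hi, hpos⟩
  exact hi ▸ (hv m).lt_rank_of_pos hpos

theorem tendsto_gram_frameEigenvector (hA : IsEigenexpansion A α u)
    (hv : ∀ m, IsEigensystem (Matrix.gram ℝ (ψ m)) (ℓ m) (v m)) (hc : ∀ m, 0 ≤ c m)
    (hlim : Tendsto (fun m => c m • frameOperator (ψ m)) l (𝓝 A)) :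
    Tendsto (fun m => Matrix.gram ℝ fun q : NonzeroIndex α =>
      Function.extend Fin.val (frameEigenvector (ψ m) (ℓ m) (v m)) 0 q) l (𝓝 1) := by
  refine tendsto_pi_nhds.2 fun p => tendsto_pi_nhds.2 fun q => tendsto_const_nhds.congr' ?_
  filter_upwards [hA.eventually_exists_eigenvalue_pos hv hc hlim p.2,
    hA.eventually_exists_eigenvalue_pos hv hc hlim q.2] with m ⟨i, hi, hpi⟩ ⟨j, hj, hpj⟩
  have horth := orthonormal_iff_ite.1 (hv m).orthonormal_frameEigenvector ⟨i, hpi.ne'⟩ ⟨j, hpj.ne'⟩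
  simp only [Matrix.gram_apply, ← hi, ← hj, Fin.val_injective.extend_apply, horth, Matrix.one_apply,
    Subtype.ext_iff, Fin.ext_iff]

theorem tendsto_apply_frameEigenvector_sub (hA : IsEigenexpansion A α u)
    (hv : ∀ m, IsEigensystem (Matrix.gram ℝ (ψ m)) (ℓ m) (v m)) (hc : ∀ m, 0 ≤ c m)
    (hlim : Tendsto (fun m => c m • frameOperator (ψ m)) l (𝓝 A)) (q : NonzeroIndex α) :
    Tendsto (fun m => A (Function.extend Fin.val (frameEigenvector (ψ m) (ℓ m) (v m)) 0 q) -
      α q • Function.extend Fin.val (frameEigenvector (ψ m) (ℓ m) (v m)) 0 (q : ℕ)) l (𝓝 0) := by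
  have herr : Tendsto (fun m => ‖A - c m • frameOperator (ψ m)‖ +
      |c m * Function.extend Fin.val (ℓ m) 0 (q : ℕ) - α q|) l (𝓝 0) := by
    simpa using (hlim.const_sub A).norm.add
      ((hA.tendsto_eigenvalue hv hc hlim q).sub_const (α q)).abs
  refine squeeze_zero_norm' ?_ herr
  filter_upwards [hA.eventually_exists_eigenvalue_pos hv hc hlim q.2] with m ⟨i, hi, hpos⟩
  simp only [← hi, Fin.val_injective.extend_apply]
  set w := frameEigenvector (ψ m) (ℓ m) (v m) i
  have hw : ‖w‖ = 1 := (hv m).orthonormal_frameEigenvector.1 ⟨i, hpos.ne'⟩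
  have hsplit : A w - α i • w =
      (A - c m • frameOperator (ψ m)) w + (c m * ℓ m i - α i) • w := by
    rw [_root_.sub_apply, _root_.smul_apply, (hv m).frameOperator_frameEigenvector, sub_smul,
      mul_smul]
    abel
  calc ‖A w - α i • w‖ ≤ ‖A - c m • frameOperator (ψ m)‖ * ‖w‖ + |c m * ℓ m i - α i| * ‖w‖ := by
        rw [hsplit]
        refine norm_add_le_of_le ((A - c m • frameOperator (ψ m)).le_opNorm w) ?_
        rw [norm_smul, Real.norm_eq_abs]
    _ = _ := by rw [hw, mul_one, mul_one]

end IsEigenexpansion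

theorem IsEigenbasis.exists_tendsto_sub_frameEigenvector [CompleteSpace H]
    {b : HilbertBasis (NonzeroIndex α) ℝ H}
    (hb : IsEigenbasis A (fun q : NonzeroIndex α => α q) b) (hα : Antitone α) (hα₀ : ∀ q, 0 ≤ α q)
    (hsum : Summable fun q : NonzeroIndex α => α q)
    (hv : ∀ m, IsEigensystem (Matrix.gram ℝ (ψ m)) (ℓ m) (v m)) (hc : ∀ m, 0 ≤ c m)
    (hlim : Tendsto (fun m => c m • frameOperator (ψ m)) l (𝓝 A)) :
    ∃ b' : κ → HilbertBasis (NonzeroIndex α) ℝ H,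
      (∀ m, IsEigenbasis A (fun q : NonzeroIndex α => α q) (b' m)) ∧
      ∀ q : NonzeroIndex α, Tendsto (fun m => b' m q -
        Function.extend Fin.val (frameEigenvector (ψ m) (ℓ m) (v m)) 0 (q : ℕ)) l (𝓝 0) :=
  hb.exists_tendsto_sub hsum.tendsto_cofinite_zero (fun q => q.2)
    ((hb.isEigenexpansion hα hα₀).tendsto_apply_frameEigenvector_sub hv hc hlim)
    ((hb.isEigenexpansion hα hα₀).tendsto_gram_frameEigenvector hv hc hlim)

end FrameOperatorLimit

section Convergence

variable {X H : Type*} [MeasurableSpace X] [TopologicalSpace X] [CompactSpace X]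
  [OpensMeasurableSpace X] {ν : Measure X} [IsFiniteMeasure ν] [NormedAddCommGroup H]
  [InnerProductSpace ℝ H] [CompleteSpace H] {φ : X → H}

theorem IsEquidistributed.tendsto_smul_frameOperator {N : ℕ → ℕ} {a : ∀ m, Fin (N m) → X}
    (ha : IsEquidistributed ν a) (hφ : Continuous φ) :
    Tendsto (fun m => (ν.real Set.univ * (N m : ℝ)⁻¹) • frameOperator (φ ∘ a m)) atTop
      (𝓝 (covariance ν φ)) := by
  have hlim := (ha.tendsto_average (continuous_rankOne_self hφ)).const_smul (ν.real Set.univ)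
  have hcov : ν.real Set.univ • (ν.real Set.univ)⁻¹ •
      ∫ x, InnerProductSpace.rankOne ℝ (φ x) (φ x) ∂ν = covariance ν φ := by
    by_cases hν : ν.real Set.univ = 0
    · rw [measureReal_eq_zero_iff, Measure.measure_univ_eq_zero] at hν
      simp [covariance, hν]
    · rw [smul_inv_smul₀ hν, covariance]
  rw [hcov] at hlim
  simpa only [frameOperator, mul_smul, Function.comp_apply] using hlim

theorem IsEquidistributed.exists_tendsto_sub_frameEigenvector {N : ℕ → ℕ}
    {a : ∀ m, Fin (N m) → X} {ℓ : ∀ m, Fin (N m) → ℝ} {v : ∀ m, Fin (N m) → Fin (N m) → ℝ}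
    {α : ℕ → ℝ} {b : HilbertBasis (NonzeroIndex α) ℝ H} (ha : IsEquidistributed ν a)
    (hφ : Continuous φ) (hb : IsEigenbasis (covariance ν φ) (fun q : NonzeroIndex α => α q) b)
    (hα : Antitone α) (hα₀ : ∀ q, 0 ≤ α q)
    (hv : ∀ m, IsEigensystem (Matrix.gram ℝ (φ ∘ a m)) (ℓ m) (v m)) :
    ∃ b' : ℕ → HilbertBasis (NonzeroIndex α) ℝ H,
      (∀ m, IsEigenbasis (covariance ν φ) (fun q : NonzeroIndex α => α q) (b' m)) ∧
      ∀ q : NonzeroIndex α, (∀ᶠ m in atTop, (q : ℕ) < (Matrix.gram ℝ (φ ∘ a m)).rank) ∧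
        Tendsto (fun m => b' m q -
          Function.extend Fin.val (frameEigenvector (φ ∘ a m) (ℓ m) (v m)) 0 (q : ℕ))
          atTop (𝓝 0) := by
  have hlim := ha.tendsto_smul_frameOperator hφ
  have hc (m : ℕ) : 0 ≤ ν.real Set.univ * (N m : ℝ)⁻¹ := by positivity
  obtain ⟨b', hb', hclose⟩ := hb.exists_tendsto_sub_frameEigenvector hα hα₀
    (hb.summable hφ fun q => hα₀ q) hv hc hlim
  exact ⟨b', hb', fun q =>
    ⟨(hb.isEigenexpansion hα hα₀).eventually_lt_rank hv hc hlim q.2, hclose q⟩⟩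

end Convergence

section ReproducingKernel

variable {X H : Type*} [NormedAddCommGroup H] [InnerProductSpace ℝ H]

theorem kernelMatrix_featureKernel (φ : X → H) {N : ℕ} (a : Fin N → X) :
    kernelMatrix (featureKernel φ) a = Matrix.gram ℝ (φ ∘ a) := rfl

variable [RKHS ℝ H X ℝ]

theorem IsReproducingKernel.exists_featureMap [TopologicalSpace X] {k : X → X → ℝ}
    (hrep : IsReproducingKernel H k) (hk : Continuous (Function.uncurry k)) :
    ∃ φ : X → H, Continuous φ ∧ k = featureKernel φ ∧ ∀ x (f : H), f x = ⟪φ x, f⟫_ℝ := by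
  choose φ hφk heval using hrep
  have hkφ (x y : X) : k x y = ⟪φ x, φ y⟫_ℝ := by rw [← heval, hφk]
  refine ⟨φ, continuous_iff_continuousAt.2 fun x => ?_, funext₂ hkφ, heval⟩
  have hdist (y : X) : ‖φ y - φ x‖ = √(k y y - 2 * k y x + k x x) := by
    rw [hkφ, hkφ, hkφ, real_inner_self_eq_norm_sq, real_inner_self_eq_norm_sq,
      ← norm_sub_sq_real, Real.sqrt_sq (norm_nonneg _)]
  have hc : Continuous fun y => √(k y y - 2 * k y x + k x x) := by
    fun_prop
  have hlim := hc.tendsto x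
  simp only [← hdist, sub_self, norm_zero] at hlim
  exact tendsto_iff_norm_sub_tendsto_zero.2 hlim

variable {ev : ℕ → ℝ} {e : ℕ → X → ℝ}

theorem HasExpansion.hasSum_apply {χ : H} {μ : NonzeroIndex ev → ℝ}
    (h : HasExpansion ev e χ μ) (x : X) :
    HasSum (fun q : NonzeroIndex ev => μ q * (√(ev q) * e q x)) (χ x) := by
  obtain ⟨u, hu, hsum⟩ := h
  simpa [hu] using Pi.hasSum.1 (hsum.mapL (RKHS.coeCLM ℝ)) x

theorem hasExpansion_iff (b : HilbertBasis (NonzeroIndex ev) ℝ H)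
    (hb : ∀ q x, b q x = √(ev q) * e q x) {χ : H} {μ : NonzeroIndex ev → ℝ} :
    HasExpansion ev e χ μ ↔ ∀ q, μ q = ⟪b q, χ⟫_ℝ := by
  constructor
  · rintro ⟨u, hu, hsum⟩ q
    obtain rfl : u = b := by
      ext q x
      rw [hu, hb]
    have hzero (p : NonzeroIndex ev) (hp : p ≠ q) : ⟪b q, μ p • b p⟫_ℝ = 0 := by
      rw [real_inner_smul_right, b.orthonormal.2 hp.symm, mul_zero]
    have hsingle : ⟪b q, μ q • b q⟫_ℝ = ⟪b q, χ⟫_ℝ :=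
      (hasSum_single q hzero).unique (hsum.mapL (innerSL ℝ (b q)))
    rw [← hsingle, real_inner_smul_right, inner_self_eq_one_of_norm_eq_one (b.orthonormal.1 q),
      mul_one]
  · intro h
    exact ⟨b, hb, by simpa only [b.repr_apply_apply, ← h] using b.hasSum_repr χ⟩

theorem existsUnique_hasExpansion (b : HilbertBasis (NonzeroIndex ev) ℝ H)
    (hb : ∀ q x, b q x = √(ev q) * e q x) (χ : H) : ∃! μ, HasExpansion ev e χ μ :=
  ⟨fun q => ⟪b q, χ⟫_ℝ, (hasExpansion_iff b hb).2 fun _ => rfl,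
    fun _ hμ => funext ((hasExpansion_iff b hb).1 hμ)⟩

theorem HasExpansion.hasSum_mul (b : HilbertBasis (NonzeroIndex ev) ℝ H)
    (hb : ∀ q x, b q x = √(ev q) * e q x) {χ₁ χ₂ : H} {μ₁ μ₂ : NonzeroIndex ev → ℝ}
    (h₁ : HasExpansion ev e χ₁ μ₁) (h₂ : HasExpansion ev e χ₂ μ₂) :
    HasSum (fun q => μ₁ q * μ₂ q) ⟪χ₁, χ₂⟫_ℝ := by
  simpa only [(hasExpansion_iff b hb).1 h₁, (hasExpansion_iff b hb).1 h₂, real_inner_comm]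
    using b.hasSum_inner_mul_inner χ₁ χ₂

theorem IsEigensystem.abs_sub_le_of_hasExpansion {φ : X → H} {N : ℕ} {a : Fin N → X}
    {ℓ : Fin N → ℝ} {v : Fin N → Fin N → ℝ}
    (hv : IsEigensystem (Matrix.gram ℝ (φ ∘ a)) ℓ v) (heval : ∀ x (f : H), f x = ⟪φ x, f⟫_ℝ)
    {b : HilbertBasis (NonzeroIndex ev) ℝ H} (hb : ∀ q x, b q x = √(ev q) * e q x)
    {χ : H} {μ : NonzeroIndex ev → ℝ} (hμ : HasExpansion ev e χ μ) {β : Fin N → ℝ}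
    (hχ : ∀ x, χ x = ∑ l, β l * featureKernel φ x (a l)) (q : NonzeroIndex ev) (i : Fin N) :
    |μ q - √(ℓ i) * (v i ⬝ᵥ β)| ≤ ‖b q - frameEigenvector (φ ∘ a) ℓ v i‖ * ‖χ‖ := by
  have hχβ : χ = Fintype.linearCombination ℝ (φ ∘ a) β := by
    ext x
    rw [hχ, heval, Fintype.linearCombination_apply, inner_sum]
    simp only [inner_smul_right, featureKernel, Function.comp_apply]
  rw [(hasExpansion_iff b hb).1 hμ q, ← hv.inner_frameEigenvector_linearCombination, ← hχβ,
    ← inner_sub_left]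
  exact abs_real_inner_le_norm _ _

end ReproducingKernel

section Lebesgue

variable {n : ℕ} {E : Set (EuclideanSpace ℝ (Fin n))}

theorem isFiniteMeasure_lebesgueOn (hE : IsCompact E) : IsFiniteMeasure (lebesgueOn E) := by
  refine ⟨?_⟩
  rw [comap_subtype_coe_apply hE.measurableSet, Set.image_univ, Subtype.range_coe]
  exact hE.measure_lt_top

theorem isOpenPosMeasure_lebesgueOn (hE : MeasurableSet E)
    (hsupp : ∀ U : Set (EuclideanSpace ℝ (Fin n)), IsOpen U → (E ∩ U).Nonempty →
      0 < volume (E ∩ U)) : (lebesgueOn E).IsOpenPosMeasure := by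
  refine ⟨fun U hU hne => ?_⟩
  obtain ⟨V, hV, rfl⟩ := isOpen_induced_iff.1 hU
  obtain ⟨x, hx⟩ := hne
  rw [comap_subtype_coe_apply hE, Subtype.image_preimage_coe]
  exact (hsupp V hV ⟨x, x.2, hx⟩).ne'

end Lebesgue

theorem theorem3_general {X : Type*} [TopologicalSpace X] [CompactSpace X] [MeasurableSpace X]
    [OpensMeasurableSpace X] {ν : Measure X} [IsFiniteMeasure ν] [ν.IsOpenPosMeasure]
    (k : X → X → ℝ) (hk : Continuous (Function.uncurry k))
    {H : Type*} [NormedAddCommGroup H] [InnerProductSpace ℝ H] [CompleteSpace H] [RKHS ℝ H X ℝ]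
    (hrep : IsReproducingKernel H k)
    (ev : ℕ → ℝ) (e : ℕ → X → ℝ) (hspec : IsSpectralDecomposition ν k ev e) :
    (∃ b : HilbertBasis (NonzeroIndex ev) ℝ H, ∀ q x, b q x = √(ev q) * e q x) ∧
    (∀ χ : H, ∃! μ : NonzeroIndex ev → ℝ, HasExpansion ev e χ μ) ∧
    (∀ (χ : H) (μ : NonzeroIndex ev → ℝ), HasExpansion ev e χ μ →
      ∀ x, HasSum (fun q : NonzeroIndex ev => μ q * (√(ev q) * e q x)) (χ x)) ∧
    (∀ (χ₁ χ₂ : H) (μ₁ μ₂ : NonzeroIndex ev → ℝ),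
      HasExpansion ev e χ₁ μ₁ → HasExpansion ev e χ₂ μ₂ →
      HasSum (fun q => μ₁ q * μ₂ q) ⟪χ₁, χ₂⟫_ℝ) ∧
    (∀ (N : ℕ) (a : Fin N → X) (q : ℕ), q < (kernelMatrix k a).rank → ev q ≠ 0) ∧
    (∀ (N : ℕ → ℕ) (a : ∀ m, Fin (N m) → X), IsEquidistributed ν a →
      ∀ (ℓ : ∀ m, Fin (N m) → ℝ) (v : ∀ m, Fin (N m) → Fin (N m) → ℝ),
      (∀ m, IsEigensystem (kernelMatrix k (a m)) (ℓ m) (v m)) →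
      ∃ e' : ℕ → ℕ → X → ℝ,
        (∀ m, IsSpectralDecomposition ν k ev (e' m)) ∧
        (∀ m q, ev q ≠ 0 → (∀ p, p ≠ q → ev p ≠ ev q) → e' m q = e q ∨ e' m q = -e q) ∧
        ∀ q : NonzeroIndex ev,
          (∀ᶠ m in atTop, (q : ℕ) < (kernelMatrix k (a m)).rank) ∧
          ∀ ε : ℝ, 0 < ε → ∀ᶠ m in atTop, ∀ hq : (q : ℕ) < N m,
            (q : ℕ) < (kernelMatrix k (a m)).rank →
            ∀ (β : Fin (N m) → ℝ) (χ : H) (μ : NonzeroIndex ev → ℝ),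
              (∀ x, χ x = ∑ l, β l * k x (a m l)) → HasExpansion ev (e' m) χ μ →
              |μ q - √(ℓ m ⟨q, hq⟩) * (v m ⟨q, hq⟩ ⬝ᵥ β)| ≤ ε * ‖χ‖) := by
  obtain ⟨φ, hφ, rfl, heval⟩ := hrep.exists_featureMap hk
  have hev := hspec.eigenvalue_nonneg hφ
  obtain ⟨b, hbe, hb⟩ := hspec.exists_hilbertBasis hφ fun f hf =>
    RKHS.ext fun x => by rw [heval, hf, RKHS.coe_zero, Pi.zero_apply]
  simp only [← heval] at hbe
  simp only [kernelMatrix_featureKernel]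
  refine ⟨⟨b, hbe⟩, existsUnique_hasExpansion b hbe, fun χ μ => HasExpansion.hasSum_apply,
    fun χ₁ χ₂ μ₁ μ₂ => HasExpansion.hasSum_mul b hbe,
    fun N a q => ne_zero_of_lt_rank_gram hspec.antitone hev b (φ ∘ a), fun N a ha ℓ v hv => ?_⟩
  obtain ⟨b', hb', hlim⟩ :=
    ha.exists_tendsto_sub_frameEigenvector hφ hb hspec.antitone hev hv
  refine ⟨fun m => eigenfunction φ (b' m), fun m => (hb' m).isSpectralDecomposition hφ
    hspec.antitone hev, fun m q hq hsimple => ?_, fun q => ⟨(hlim q).1, fun ε hε => ?_⟩⟩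
  · lift q to NonzeroIndex ev using hq
    have hq : eigenfunction φ b q = e q := eigenfunction_eq hev fun x => by rw [← heval, hbe]
    exact hq ▸ hb.eigenfunction_eq_or_eq_neg (hb' m) φ hsimple
  · filter_upwards [(hlim q).2.norm.eventually_le_const (norm_zero.trans_lt hε)] with
      m hm hq _ β χ μ hχ hμ
    have hbe' (p : NonzeroIndex ev) (x : X) : b' m p x = √(ev p) * eigenfunction φ (b' m) p x := by
      rw [heval, sqrt_mul_eigenfunction hev]
    refine ((hv m).abs_sub_le_of_hasExpansion heval hbe' hμ hχ q ⟨q, hq⟩).trans ?_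
    rw [← Fin.val_injective.extend_apply (frameEigenvector _ _ _) 0]
    gcongr

theorem theorem3 {n : ℕ} (E : Set (EuclideanSpace ℝ (Fin n))) (hE : IsCompact E)
    (hsupp : ∀ U : Set (EuclideanSpace ℝ (Fin n)), IsOpen U → (E ∩ U).Nonempty →
      0 < volume (E ∩ U))
    (k : E → E → ℝ) (hk : Continuous (Function.uncurry k))
    {H : Type*} [NormedAddCommGroup H] [InnerProductSpace ℝ H] [CompleteSpace H] [RKHS ℝ H E ℝ]
    (hrep : IsReproducingKernel H k)
    (ev : ℕ → ℝ) (e : ℕ → E → ℝ) (hspec : IsSpectralDecomposition (lebesgueOn E) k ev e) :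
    -- the functions `√(ev q) • e q` form an orthonormal basis of the space
    (∃ b : HilbertBasis (NonzeroIndex ev) ℝ H, ∀ q x, b q x = √(ev q) * e q x) ∧
    -- every element has a unique expansion, which also holds at every point
    (∀ χ : H, ∃! μ : NonzeroIndex ev → ℝ, HasExpansion ev e χ μ) ∧
    (∀ (χ : H) (μ : NonzeroIndex ev → ℝ), HasExpansion ev e χ μ →
      ∀ x, HasSum (fun q : NonzeroIndex ev => μ q * (√(ev q) * e q x)) (χ x)) ∧
    -- the inner product in terms of the coefficients
    (∀ (χ₁ χ₂ : H) (μ₁ μ₂ : NonzeroIndex ev → ℝ),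
      HasExpansion ev e χ₁ μ₁ → HasExpansion ev e χ₂ μ₂ →
      HasSum (fun q => μ₁ q * μ₂ q) ⟪χ₁, χ₂⟫_ℝ) ∧
    -- a Gram matrix has no more nonzero eigenvalues than the integral operator
    (∀ (N : ℕ) (a : Fin N → E) (q : ℕ), q < (kernelMatrix k a).rank → ev q ≠ 0) ∧
    -- approximation of the first `d = rank` coefficients from the eigenpairs of the Gram matrix
    (∀ (N : ℕ → ℕ) (a : ∀ m, Fin (N m) → E), IsEquidistributed (lebesgueOn E) a →
      ∀ (ℓ : ∀ m, Fin (N m) → ℝ) (v : ∀ m, Fin (N m) → Fin (N m) → ℝ),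
      (∀ m, IsEigensystem (kernelMatrix k (a m)) (ℓ m) (v m)) →
      ∃ e' : ℕ → ℕ → E → ℝ,
        (∀ m, IsSpectralDecomposition (lebesgueOn E) k ev (e' m)) ∧
        (∀ m q, ev q ≠ 0 → (∀ p, p ≠ q → ev p ≠ ev q) → e' m q = e q ∨ e' m q = -e q) ∧
        ∀ q : NonzeroIndex ev,
          (∀ᶠ m in atTop, (q : ℕ) < (kernelMatrix k (a m)).rank) ∧
          ∀ ε : ℝ, 0 < ε → ∀ᶠ m in atTop, ∀ hq : (q : ℕ) < N m,
            (q : ℕ) < (kernelMatrix k (a m)).rank →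
            ∀ (β : Fin (N m) → ℝ) (χ : H) (μ : NonzeroIndex ev → ℝ),
              (∀ x, χ x = ∑ l, β l * k x (a m l)) → HasExpansion ev (e' m) χ μ →
              |μ q - √(ℓ m ⟨q, hq⟩) * (v m ⟨q, hq⟩ ⬝ᵥ β)| ≤ ε * ‖χ‖) := by
  have : CompactSpace E := isCompact_iff_compactSpace.1 hE
  have := isFiniteMeasure_lebesgueOn hE
  have := isOpenPosMeasure_lebesgueOn hE.measurableSet hsupp
  exact theorem3_general k hk hrep ev e hspec
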